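/- Let $m$ clients have loss functions $F_i(\cdot\,;\xi):\mathbb{R}^d\to\mathbb{R}$ (measurable, and differentiable in the model for every $\xi$) and data distributions $\mathcal{D}_i$, and let $F_i(x)=\mathbb{E}_{\xi\sim\mathcal{D}_i}F_i(x;\xi)$ (assumed to exist) and $f=\frac1m\sum_{i=1}^m F_i$, where $f$ is bounded below with infimum $f_*$. Assume that for all $x,y,i,\xi$: 1. (smoothness) $|F_i(x)-F_i(y)-\langle\nabla F_i(y),x-y\rangle|\le\frac L2\|x-y\|^2$; 2. (bounded gradients) $\|\nabla F_i(x;\xi)\|\le G$; 3. (bounded variances) $\mathbb{E}_{\xi\sim\mathcal{D}_i}\|\nabla F_i(x;\xi)-\nabla F_i(x)\|^2\le\sigma_l^2$ and $\frac1m\sum_{i=1}^m\|\nabla F_i(x)-\nabla f(x)\|^2\le\sigma_g^2$. FedAMS with partial participation starts from $x_1$ with $m_0=b_0=\hat b_0=0$ and runs $T$ rounds. In round $t$ a set $\mathcal{S}_t$ of $n$ clients ($1\le n\le m$) is drawn uniformly without replacement. Each $i\in\mathcal{S}_t$ sets $x_{t,0}^i=x_t$ and makes $K\ge1$ local steps $x_{t,k+1}^i=x_{t,k}^i-\eta_l\nabla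 F_i(x_{t,k}^i;\xi_{t,k}^i)$ with $\xi_{t,k}^i\sim\mathcal{D}_i$; all the samples and the sets $\mathcal{S}_t$ are independent. With $\Delta_t=\frac1n\sum_{i\in\mathcal{S}_t}(x_{t,K}^i-x_t)$ the server sets, coordinatewise, $$m_t=\beta_1m_{t-1}+(1-\beta_1)\Delta_t,\quad b_t=\beta_2b_{t-1}+(1-\beta_2)\Delta_t^2,\quad \hat b_t=\max(\hat b_{t-1},b_t,\epsilon),\quad x_{t+1}=x_t+\eta\,\frac{m_t}{\sqrt{\hat b_t}},$$ where $0\le\beta_1<1$, $0\le\beta_2\le1$ and $\epsilon>0$. Suppose that $\eta=\Theta(\sqrt{Kn})$ and $\eta_l=\Theta\big(\frac1{\sqrt T\,K}\big)$, that is, $a_1\sqrt{Kn}\le\eta\le a_2\sqrt{Kn}$ and $\frac{b_1}{\sqrt T\,K}\le\eta_l\le\frac{b_2}{\sqrt T\,K}$ with $a_1,b_1>0$. Then, for $T$ sufficiently large, $$\min_{1\le t\le T}\mathbb{E}\big[\|\nabla f(x_t)\|^2\big]=\mathcal{O}\Big(\frac{\sqrt K}{\sqrt{Tn}}\Big).$$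 Precisely: there are constants $C,C_0>0$, depending only on $d,L,G,\sigma_l,\sigma_g,\epsilon,\beta_1,\beta_2,a_1,a_2,b_1,b_2$ and an upper bound for $f(x_1)-f_*$ (and not on $m,n,K,T$), such that whenever $T\ge1$ and $T\ge C_0Kn$ the expectations exist and the minimum is at most $C\sqrt K/\sqrt{Tn}$. -/

import Mathlib

open MeasureTheory ProbabilityTheory
open scoped ENNReal

noncomputable section

namespace FedOpt

/-- The model space `ℝ^d` with its Euclidean norm. -/
abbrev Vec (d : ℕ) : Type := EuclideanSpace ℝ (Fin d)

variable {d m : ℕ} {Ξ : Type*}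

/-! ### The federated objective -/

/-- The local objective `F_i(x) = 𝔼_{ξ ∼ D_i} F_i(x; ξ)` of client `i`. -/
def localObj [MeasurableSpace Ξ] (D : Fin m → Measure Ξ) (F : Fin m → Vec d → Ξ → ℝ)
    (i : Fin m) (x : Vec d) : ℝ :=
  ∫ ξ, F i x ξ ∂(D i)

/-- The global objective `f(x) = (1/m) ∑ i, F_i(x)`. -/
def globalObj [MeasurableSpace Ξ] (D : Fin m → Measure Ξ) (F : Fin m → Vec d → Ξ → ℝ)
    (x : Vec d) : ℝ :=
  (1 / (m : ℝ)) * ∑ i, localObj D F i x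

/-- The stochastic gradient `∇F_i(x; ξ)` (gradient with respect to the model `x`). -/
def stochGrad (F : Fin m → Vec d → Ξ → ℝ) (i : Fin m) (x : Vec d) (ξ : Ξ) : Vec d :=
  gradient (fun y => F i y ξ) x

/-- What is taken for granted for the losses `F_i(x; ξ)` to make sense: they are measurable,
differentiable in the model, and the expectation defining `F_i` exists. -/
structure IsLossFamily [MeasurableSpace Ξ] (D : Fin m → Measure Ξ)
    (F : Fin m → Vec d → Ξ → ℝ) : Prop where
  measurable : ∀ i, Measurable (fun p : Vec d × Ξ => F i p.1 p.2)
  differentiable : ∀ i ξ, Differentiable ℝ (fun x => F i x ξ)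
  integrable : ∀ i x, Integrable (F i x) (D i)

/-- Every local objective is `L`-smooth. -/
def IsSmoothFamily [MeasurableSpace Ξ] (D : Fin m → Measure Ξ)
    (F : Fin m → Vec d → Ξ → ℝ) (L : ℝ) : Prop :=
  ∀ i x y,
    |localObj D F i x - localObj D F i y - inner ℝ (gradient (localObj D F i) y) (x - y)|
      ≤ L / 2 * ‖x - y‖ ^ 2

/-- All stochastic gradients are bounded by `G` in the `ℓ₂` norm. -/
def HasBoundedGrad (F : Fin m → Vec d → Ξ → ℝ) (G : ℝ) : Prop :=
  ∀ i x ξ, ‖stochGrad F i x ξ‖ ≤ G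

/-- The local (stochastic) variance of every client is at most `σl ^ 2`. -/
def HasLocalVariance [MeasurableSpace Ξ] (D : Fin m → Measure Ξ)
    (F : Fin m → Vec d → Ξ → ℝ) (σl : ℝ) : Prop :=
  ∀ i x, ∫ ξ, ‖stochGrad F i x ξ - gradient (localObj D F i) x‖ ^ 2 ∂(D i) ≤ σl ^ 2

/-- The global variance (heterogeneity of the clients) is at most `σg ^ 2`. -/
def HasGlobalVariance [MeasurableSpace Ξ] (D : Fin m → Measure Ξ)
    (F : Fin m → Vec d → Ξ → ℝ) (σg : ℝ) : Prop :=
  ∀ x, (1 / (m : ℝ)) * ∑ i, ‖gradient (localObj D F i) x - gradient (globalObj D F) x‖ ^ 2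
    ≤ σg ^ 2

/-! ### The algorithm FedAMS -/

/-- Local SGD of one client: `localSGD g ηl x ξ k` is the local model after `k` steps started at
`x`, with stochastic gradient `g` and step size `ηl`, where step `k` uses the sample `ξ k`. -/
def localSGD (g : Vec d → Ξ → Vec d) (ηl : ℝ) (x : Vec d) (ξ : ℕ → Ξ) : ℕ → Vec d
  | 0 => x
  | k + 1 => localSGD g ηl x ξ k - ηl • g (localSGD g ηl x ξ k) (ξ k)

/-- The averaged model difference `Δ = (1/|S|) ∑ i ∈ S, (x_{i,K} - x)` over the participating
clients `S`, after `K` local steps from the global model `x`. -/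
def modelDiff (g : Fin m → Vec d → Ξ → Vec d) (K : ℕ) (ηl : ℝ) (x : Vec d)
    (S : Finset (Fin m)) (ξ : Fin m → ℕ → Ξ) : Vec d :=
  (1 / (S.card : ℝ)) • ∑ i ∈ S, (localSGD (g i) ηl x (ξ i) K - x)

/-- The state of the server: global model, momentum, second moment `b` and its running maximum
`bhat`. -/
structure ServerState (d : ℕ) where
  model : Vec d
  mom : Vec d
  b : Vec d
  bhat : Vec d

/-- The server update with pseudo-gradient `Δ`; squares, maxima, roots and quotients of vectors
are taken coordinatewise:
`m ← β₁ m + (1 - β₁) Δ`, `b ← β₂ b + (1 - β₂) Δ²`, `bhat ← max (bhat, b, ε)`,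
`x ← x + η m / √bhat`. -/
def serverUpdate (η β₁ β₂ ε : ℝ) (s : ServerState d) (Δ : Vec d) : ServerState d :=
  let mom : Vec d := β₁ • s.mom + (1 - β₁) • Δ
  let b : Vec d := WithLp.toLp 2 fun j => β₂ * s.b j + (1 - β₂) * (Δ j) ^ 2
  let bhat : Vec d := WithLp.toLp 2 fun j => max (max (s.bhat j) (b j)) ε
  { model := WithLp.toLp 2 fun j => s.model j + η * (mom j / Real.sqrt (bhat j))
    mom := mom
    b := b
    bhat := bhat }

/-- FedAMS from the initial model `x₁`: the state after `t` communication rounds, where the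
round with (zero-based) number `t` has participating clients `S t` and samples `ξ t i k`
(client `i`, local step `k`). -/
def fedAMSState (g : Fin m → Vec d → Ξ → Vec d) (K : ℕ) (η ηl β₁ β₂ ε : ℝ) (x₁ : Vec d)
    (S : ℕ → Finset (Fin m)) (ξ : ℕ → Fin m → ℕ → Ξ) : ℕ → ServerState d
  | 0 => { model := x₁, mom := 0, b := 0, bhat := 0 }
  | t + 1 =>
    let s := fedAMSState g K η ηl β₁ β₂ ε x₁ S ξ t
    serverUpdate η β₁ β₂ ε s (modelDiff g K ηl s.model (S t) (ξ t))

/-- The global models of FedAMS, numbered from `0`: `fedAMS … t` is the global model at the start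
of the round with zero-based number `t`, so the models `x_1, …, x_T` of `T` rounds
are the values at `t = 0, …, T - 1`. -/
def fedAMS (g : Fin m → Vec d → Ξ → Vec d) (K : ℕ) (η ηl β₁ β₂ ε : ℝ) (x₁ : Vec d)
    (S : ℕ → Finset (Fin m)) (ξ : ℕ → Fin m → ℕ → Ξ) (t : ℕ) : Vec d :=
  (fedAMSState g K η ηl β₁ β₂ ε x₁ S ξ t).model

/-! ### The randomness -/

/-- Partial participation without replacement: on the probability space `(Ω, P)`, the set `S t`
of participating clients in round `t` is uniform among the `n`-element sets of clients, the
sample `ξ t i k` of client `i` at local step `k` of round `t` has law `D i`, and all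
these random variables are independent. -/
structure IsPartialParticipation {Ω : Type*} [MeasurableSpace Ω] [MeasurableSpace Ξ]
    (P : Measure Ω) (D : Fin m → Measure Ξ) (n : ℕ)
    (S : ℕ → Ω → Finset (Fin m)) (ξ : ℕ → Fin m → ℕ → Ω → Ξ) : Prop where
  measurable_clients : ∀ t A, MeasurableSet (S t ⁻¹' {A})
  measurable_samples : ∀ t i k, Measurable (ξ t i k)
  uniform_clients : ∀ t (A : Finset (Fin m)), A.card = n →
    P (S t ⁻¹' {A}) = ((m.choose n : ℕ) : ℝ≥0∞)⁻¹
  law_samples : ∀ t i k, P.map (ξ t i k) = D i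
  indep : iIndep
    (Sum.elim
      (fun t : ℕ => MeasurableSpace.comap (S t) ⊤)
      (fun q : ℕ × Fin m × ℕ =>
        MeasurableSpace.comap (ξ q.1 q.2.1 q.2.2) inferInstance)) P

end FedOpt

end

/-! For large `T` the adaptivity is inactive. A pseudo-gradient has norm at most `ηl K G`, of order
`1 / √T`, so once `T` exceeds a constant the second moments never rise above `ε`, the running
maximum equals its floor `ε` after every update, and FedAMS is exactly SGD with momentum and scalar
step `α = η / √ε` (`fedAMSState_bhat_succ`, `fedAMSState_model_succ`).

For one round started at a fixed `x`, put `γ = ηl K`. Local models drift by at most `γ G`, so the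
mean `v` of the pseudo-gradient differs from `-γ ∇f(x)` by at most `γ · 3 L γ G`. Its second moment
is at most `(γ G)² / n + ‖v‖²`: clients use independent samples, and inclusions without replacement
are not positively correlated (`exists_mean_modelDiff`, `integral_norm_sq_average_clients_le`).
Independence of the model from the coming round carries these estimates over to the random model
(`integral_round_le`).

Momentum is handled by a potential: the shifted point `z = x + (α β₁ / (1 - β₁)) m` makes a plain
step `z + α Δ`, and a multiple of `‖m‖²` pays for evaluating the gradient at `x` instead of `z`
(`potential_momentum_step_le`).

Telescoping (`sum_integral_norm_sq_gradient_le`) bounds the average of `𝔼‖∇f(x_t)‖²`, up to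
constants, by `gap / (α γ T) + γ² + α γ / n`. With `α γ` of order `√(K n / T)` and `γ` of order `1 /
√T`, the last term has order `√K / √(T n)` and the others are no larger when `K n ≤ T` (`rate_le`).
-/

namespace FedOpt

/-! ### Smooth functions -/

section Smooth

variable {E : Type*} [NormedAddCommGroup E] [InnerProductSpace ℝ E] [CompleteSpace E]

/-- A two-sided quadratic bound on the first-order Taylor remainder makes the gradient
Lipschitz. -/
theorem norm_gradient_sub_le_of_abs_taylor_le {f : E → ℝ} {L : ℝ} (hL : 0 ≤ L)
    (h : ∀ x y, |f x - f y - inner ℝ (gradient f y) (x - y)| ≤ L / 2 * ‖x - y‖ ^ 2) (x y : E) :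
    ‖gradient f x - gradient f y‖ ≤ 3 * L * ‖x - y‖ := by
  set v := gradient f y - gradient f x with hv
  rw [norm_sub_rev, ← hv]
  by_cases hv0 : ‖v‖ = 0
  · rw [hv0]; positivity
  by_cases hr0 : ‖x - y‖ = 0
  · have : x = y := by rwa [norm_eq_zero, sub_eq_zero] at hr0
    subst this
    simp [hv]
  have hvpos : 0 < ‖v‖ := lt_of_le_of_ne (norm_nonneg _) (Ne.symm hv0)
  have hrpos : 0 < ‖x - y‖ := lt_of_le_of_ne (norm_nonneg _) (Ne.symm hr0)
  set r := ‖x - y‖ with hr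
  -- The test point `x + w` has `w` parallel to the gradient difference and of length `r = ‖x - y‖`.
  -- The Taylor bounds for `(x + w, x)`, `(x + w, y)` and `(x, y)` isolate `r ‖v‖` and cost `L/2 ·
  -- (1 + 4 + 1) r² = 3 L r²`; no convexity is needed.
  set w := (r / ‖v‖) • v with hw
  have hwn : ‖w‖ = r := by
    rw [hw, norm_smul, Real.norm_of_nonneg (by positivity)]
    field_simp
  have h1 := abs_le.1 (h (x + w) x)
  have h2 := abs_le.1 (h (x + w) y)
  have h3 := abs_le.1 (h x y)
  have e1 : x + w - x = w := by abel
  have e2 : x + w - y = (x - y) + w := by abel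
  rw [e1, hwn] at h1
  rw [e2, inner_add_right] at h2
  have hn : ‖x - y + w‖ ^ 2 ≤ (2 * r) ^ 2 := by
    have : ‖x - y + w‖ ≤ 2 * r := by
      refine (norm_add_le _ _).trans ?_
      rw [hwn, ← hr]; linarith
    gcongr
  have hin : inner ℝ (gradient f y) w - inner ℝ (gradient f x) w = r * ‖v‖ := by
    rw [← inner_sub_left, ← hv, hw, inner_smul_right, real_inner_self_eq_norm_sq]
    field_simp
  have hL2 : L / 2 * ‖x - y + w‖ ^ 2 ≤ L / 2 * (2 * r) ^ 2 := by gcongr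
  have hfin : r * ‖v‖ ≤ r * (3 * L * r) := by nlinarith [h1.1, h1.2, h2.1, h2.2, h3.1, h3.2]
  exact le_of_mul_le_mul_left hfin hrpos

end Smooth

/-! ### Gradients of the losses and of the objectives -/

section Gradients

variable {d m : ℕ} {Ξ : Type*} [MeasurableSpace Ξ] {D : Fin m → Measure Ξ}
  {F : Fin m → Vec d → Ξ → ℝ} {L G : ℝ}

/-- Each partial derivative is a pointwise limit of difference quotients with step `1 / k`, which
are jointly measurable; the coordinates are then reassembled in the standard basis. -/
theorem IsLossFamily.measurable_stochGrad (hF : IsLossFamily D F) (i : Fin m) :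
    Measurable (fun p : Vec d × Ξ => stochGrad F i p.1 p.2) := by
  let b := EuclideanSpace.basisFun (Fin d) ℝ
  have hcoord : ∀ j, Measurable (fun p : Vec d × Ξ => inner ℝ (b j) (stochGrad F i p.1 p.2)) := by
    intro j
    refine measurable_of_tendsto_metrizable
      (f := fun (k : ℕ) (p : Vec d × Ξ) =>
        (k : ℝ) * (F i (p.1 + (k : ℝ)⁻¹ • b j) p.2 - F i p.1 p.2)) ?_ ?_
    · intro k
      have h : Measurable fun p : Vec d × Ξ => (p.1 + (k : ℝ)⁻¹ • b j, p.2) := by fun_prop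
      exact measurable_const.mul (((hF.measurable i).comp h).sub (hF.measurable i))
    · rw [tendsto_pi_nhds]
      rintro ⟨x, s⟩
      have h := ((hF.differentiable i s x).hasFDerivAt.lim_real (b j)).comp
        (tendsto_natCast_atTop_atTop (R := ℝ))
      simpa [stochGrad, inner_gradient_right, Function.comp_def] using h
  have : (fun p : Vec d × Ξ => stochGrad F i p.1 p.2)
      = fun p => ∑ j, inner ℝ (b j) (stochGrad F i p.1 p.2) • b j := by
    funext p
    exact (b.sum_repr' _).symm
  rw [this]
  exact Finset.measurable_fun_sum _ fun j _ => (hcoord j).smul_const _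

/-- Differentiation under the integral sign, dominated by the constant `G`. This is where
unbiasedness of the stochastic gradients comes from. -/
theorem IsLossFamily.hasGradientAt_localObj [∀ i, IsProbabilityMeasure (D i)]
    (hF : IsLossFamily D F) (hG : HasBoundedGrad F G) (i : Fin m) (x : Vec d) :
    HasGradientAt (localObj D F i) (∫ s, stochGrad F i x s ∂(D i)) x := by
  have hm : Measurable (fun s => stochGrad F i x s) :=
    (hF.measurable_stochGrad i).comp measurable_prodMk_left
  have h := hasFDerivAt_integral_of_dominated_of_fderiv_le (μ := D i) (𝕜 := ℝ)
    (F := fun x s => F i x s) (x₀ := x) (s := Set.univ) (bound := fun _ => G)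
    (F' := fun y s => InnerProductSpace.toDual ℝ (Vec d) (stochGrad F i y s))
    Filter.univ_mem
    (Filter.Eventually.of_forall fun y => (hF.integrable i y).aestronglyMeasurable)
    (hF.integrable i x)
    ((InnerProductSpace.toDual ℝ (Vec d)).continuous.comp_aestronglyMeasurable
      hm.aestronglyMeasurable)
    (Filter.Eventually.of_forall fun s y _ => by simpa using hG i y s)
    (integrable_const _)
    (Filter.Eventually.of_forall fun s y _ => by
      simpa [stochGrad] using (hF.differentiable i s y).hasGradientAt.hasFDerivAt)
  have hc := ((InnerProductSpace.toDual ℝ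
    (Vec d)).toContinuousLinearEquiv.toContinuousLinearMap).integral_comp_comm (μ := D i)
    (φ := fun s => stochGrad F i x s) (Integrable.of_bound hm.aestronglyMeasurable G
      (Filter.Eventually.of_forall fun s => hG i x s))
  exact hasGradientAt_iff_hasFDerivAt.2 (h.congr_fderiv hc)

theorem IsLossFamily.gradient_localObj [∀ i, IsProbabilityMeasure (D i)]
    (hF : IsLossFamily D F) (hG : HasBoundedGrad F G) (i : Fin m) (x : Vec d) :
    gradient (localObj D F i) x = ∫ s, stochGrad F i x s ∂(D i) :=
  (hF.hasGradientAt_localObj hG i x).gradient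

theorem IsLossFamily.hasGradientAt_globalObj [∀ i, IsProbabilityMeasure (D i)]
    (hF : IsLossFamily D F) (hG : HasBoundedGrad F G) (x : Vec d) :
    HasGradientAt (globalObj D F) ((1 / (m : ℝ)) • ∑ i, gradient (localObj D F i) x) x := by
  rw [hasGradientAt_iff_hasFDerivAt]
  have h : ∀ i ∈ (Finset.univ : Finset (Fin m)), HasFDerivAt (localObj D F i)
      (InnerProductSpace.toDual ℝ (Vec d) (gradient (localObj D F i) x)) x := fun i _ =>
    (hF.hasGradientAt_localObj hG i x).differentiableAt.hasGradientAt.hasFDerivAt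
  have h2 := (HasFDerivAt.fun_sum h).const_mul (1 / (m : ℝ))
  refine HasFDerivAt.congr_fderiv (f' := _) h2 ?_
  rw [map_smul, map_sum]

theorem IsLossFamily.gradient_globalObj [∀ i, IsProbabilityMeasure (D i)]
    (hF : IsLossFamily D F) (hG : HasBoundedGrad F G) (x : Vec d) :
    gradient (globalObj D F) x = (1 / (m : ℝ)) • ∑ i, gradient (localObj D F i) x :=
  (hF.hasGradientAt_globalObj hG x).gradient

theorem IsLossFamily.abs_globalObj_taylor_le [∀ i, IsProbabilityMeasure (D i)]
    (hF : IsLossFamily D F) (hG : HasBoundedGrad F G) (hs : IsSmoothFamily D F L) (hL : 0 ≤ L)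
    (x y : Vec d) :
    |globalObj D F x - globalObj D F y - inner ℝ (gradient (globalObj D F) y) (x - y)|
      ≤ L / 2 * ‖x - y‖ ^ 2 := by
  rw [hF.gradient_globalObj hG]
  have e : globalObj D F x - globalObj D F y
      - inner ℝ ((1 / (m : ℝ)) • ∑ i, gradient (localObj D F i) y) (x - y)
      = (1 / (m : ℝ)) * ∑ i, (localObj D F i x - localObj D F i y
          - inner ℝ (gradient (localObj D F i) y) (x - y)) := by
    simp only [globalObj, real_inner_smul_left, sum_inner, Finset.sum_sub_distrib]
    ring
  rw [e, abs_mul, abs_of_nonneg (by positivity)]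
  calc (1 / (m : ℝ)) * |∑ i, (localObj D F i x - localObj D F i y
          - inner ℝ (gradient (localObj D F i) y) (x - y))|
      ≤ (1 / (m : ℝ)) * ∑ _i : Fin m, L / 2 * ‖x - y‖ ^ 2 := by
        gcongr
        exact (Finset.abs_sum_le_sum_abs _ _).trans (Finset.sum_le_sum fun i _ => hs i x y)
    _ ≤ L / 2 * ‖x - y‖ ^ 2 := by
        rcases Nat.eq_zero_or_pos m with rfl | hm
        · simp; positivity
        · simp only [Finset.sum_const, Finset.card_univ, Fintype.card_fin, nsmul_eq_mul]
          have : (m : ℝ) ≠ 0 := by positivity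
          field_simp; rfl

theorem IsLossFamily.norm_gradient_localObj_le [∀ i, IsProbabilityMeasure (D i)]
    (hF : IsLossFamily D F) (hG : HasBoundedGrad F G) (i : Fin m) (x : Vec d) :
    ‖gradient (localObj D F i) x‖ ≤ G := by
  rw [hF.gradient_localObj hG]
  simpa using norm_integral_le_of_norm_le_const (μ := D i)
    (Filter.Eventually.of_forall fun s => hG i x s)

theorem IsLossFamily.norm_gradient_globalObj_le [∀ i, IsProbabilityMeasure (D i)]
    (hF : IsLossFamily D F) (hG : HasBoundedGrad F G) (hm : 1 ≤ m) (x : Vec d) :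
    ‖gradient (globalObj D F) x‖ ≤ G := by
  rw [hF.gradient_globalObj hG, norm_smul, Real.norm_of_nonneg (by positivity)]
  have h := norm_sum_le_of_le (Finset.univ : Finset (Fin m))
    (f := fun i => gradient (localObj D F i) x) (n := fun _ => G)
    fun i _ => hF.norm_gradient_localObj_le hG i x
  simp only [Finset.sum_const, Finset.card_univ, Fintype.card_fin, nsmul_eq_mul] at h
  have : (0 : ℝ) < m := by positivity
  rw [one_div, inv_mul_le_iff₀ this]
  exact h

end Gradients

/-! ### Sample paths of FedAMS -/

section Paths

variable {d m : ℕ} {Ξ : Type*} {g : Fin m → Vec d → Ξ → Vec d} {G ηl : ℝ}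

theorem norm_localSGD_sub_le {g : Vec d → Ξ → Vec d} (hg : ∀ x s, ‖g x s‖ ≤ G) (hηl : 0 ≤ ηl)
    (x : Vec d) (ξ : ℕ → Ξ) (k : ℕ) : ‖localSGD g ηl x ξ k - x‖ ≤ k * (ηl * G) := by
  induction k with
  | zero => simp [localSGD]
  | succ k ih =>
    have e : localSGD g ηl x ξ (k + 1) - x
        = (localSGD g ηl x ξ k - x) - ηl • g (localSGD g ηl x ξ k) (ξ k) := by
      simp only [localSGD]; abel
    rw [e]
    refine (norm_sub_le _ _).trans ?_
    rw [norm_smul, Real.norm_of_nonneg hηl]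
    have := mul_le_mul_of_nonneg_left (hg (localSGD g ηl x ξ k) (ξ k)) hηl
    push_cast
    linarith

theorem localSGD_sub_eq_sum (g : Vec d → Ξ → Vec d) (ηl : ℝ) (x : Vec d) (ξ : ℕ → Ξ) (K : ℕ) :
    localSGD g ηl x ξ K - x
      = ∑ k ∈ Finset.range K, (-ηl) • g (localSGD g ηl x ξ k) (ξ k) := by
  induction K with
  | zero => simp [localSGD]
  | succ K ih =>
    rw [Finset.sum_range_succ, ← ih]
    simp only [localSGD, neg_smul]
    abel

theorem norm_modelDiff_le (hg : ∀ i x s, ‖g i x s‖ ≤ G) (hG : 0 ≤ G) (hηl : 0 ≤ ηl) (K : ℕ)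
    (x : Vec d) (S : Finset (Fin m)) (ξ : Fin m → ℕ → Ξ) :
    ‖modelDiff g K ηl x S ξ‖ ≤ ηl * K * G := by
  rw [modelDiff, norm_smul, Real.norm_of_nonneg (by positivity)]
  have h := norm_sum_le_of_le S (f := fun i => localSGD (g i) ηl x (ξ i) K - x)
    (n := fun _ => K * (ηl * G)) fun i _ => norm_localSGD_sub_le (hg i) hηl x (ξ i) K
  rw [Finset.sum_const, nsmul_eq_mul] at h
  -- Client sets have `n` elements only almost surely, so the bound has to cover the empty set,
  -- where `1 / 0 = 0` makes the average vanish.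
  rcases S.eq_empty_or_nonempty with rfl | hS
  · simp; positivity
  · have hc : (0 : ℝ) < S.card := by exact_mod_cast hS.card_pos
    rw [one_div, inv_mul_le_iff₀ hc]
    linarith

/-! ### The server iterates and their reduction to SGD with momentum -/

section State

variable {K : ℕ} {η β₁ β₂ ε : ℝ} {x₁ : Vec d} {S : ℕ → Finset (Fin m)}
  {ξ : ℕ → Fin m → ℕ → Ξ}

theorem fedAMSState_mom_succ (t : ℕ) :
    (fedAMSState g K η ηl β₁ β₂ ε x₁ S ξ (t + 1)).mom
      = β₁ • (fedAMSState g K η ηl β₁ β₂ ε x₁ S ξ t).mom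
        + (1 - β₁) • modelDiff g K ηl (fedAMSState g K η ηl β₁ β₂ ε x₁ S ξ t).model (S t) (ξ t) :=
  rfl

theorem fedAMSState_b_le (hg : ∀ i x s, ‖g i x s‖ ≤ G) (hG : 0 ≤ G) (hηl : 0 ≤ ηl)
    (hβ₂ : 0 ≤ β₂) (hβ₂' : β₂ ≤ 1) (t : ℕ) (j : Fin d) :
    (fedAMSState g K η ηl β₁ β₂ ε x₁ S ξ t).b j ≤ (ηl * K * G) ^ 2 := by
  induction t with
  | zero => simp [fedAMSState]; positivity
  | succ t ih =>
    set s := fedAMSState g K η ηl β₁ β₂ ε x₁ S ξ t with hs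
    set Δ := modelDiff g K ηl s.model (S t) (ξ t) with hΔ
    have e : (fedAMSState g K η ηl β₁ β₂ ε x₁ S ξ (t + 1)).b j
        = β₂ * s.b j + (1 - β₂) * (Δ j) ^ 2 := rfl
    have h1 : |Δ j| ≤ ηl * K * G :=
      (PiLp.norm_apply_le Δ j).trans (norm_modelDiff_le hg hG hηl K _ _ _)
    have h2 : (Δ j) ^ 2 ≤ (ηl * K * G) ^ 2 := sq_le_sq' (abs_le.1 h1).1 (abs_le.1 h1).2
    rw [e]
    nlinarith [mul_le_mul_of_nonneg_left ih hβ₂, mul_le_mul_of_nonneg_left h2 (sub_nonneg.2 hβ₂')]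

/-- When the pseudo-gradients are small, the running maximum stays at its floor `ε`. -/
theorem fedAMSState_bhat_succ (hg : ∀ i x s, ‖g i x s‖ ≤ G) (hG : 0 ≤ G) (hηl : 0 ≤ ηl)
    (hβ₂ : 0 ≤ β₂) (hβ₂' : β₂ ≤ 1) (hε : 0 ≤ ε) (hsmall : (ηl * K * G) ^ 2 ≤ ε) (t : ℕ)
    (j : Fin d) : (fedAMSState g K η ηl β₁ β₂ ε x₁ S ξ (t + 1)).bhat j = ε := by
  have hb : ∀ t, (fedAMSState g K η ηl β₁ β₂ ε x₁ S ξ t).b j ≤ ε := fun t =>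
    (fedAMSState_b_le hg hG hηl hβ₂ hβ₂' t j).trans hsmall
  have e : ∀ t, (fedAMSState g K η ηl β₁ β₂ ε x₁ S ξ (t + 1)).bhat j
      = max (max ((fedAMSState g K η ηl β₁ β₂ ε x₁ S ξ t).bhat j)
          ((fedAMSState g K η ηl β₁ β₂ ε x₁ S ξ (t + 1)).b j)) ε := fun t => rfl
  -- Only an inequality holds for all `t`, since `bhat` starts at `0`; equality with the floor
  -- begins after one update.
  have hle : ∀ t, (fedAMSState g K η ηl β₁ β₂ ε x₁ S ξ t).bhat j ≤ ε := by
    intro t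
    induction t with
    | zero => simpa [fedAMSState] using hε
    | succ t ih => rw [e]; exact max_le (max_le ih (hb _)) le_rfl
  rw [e]
  exact max_eq_right (max_le (hle t) (hb _))

/-- When the pseudo-gradients are small, FedAMS is SGD with momentum. -/
theorem fedAMSState_model_succ (hg : ∀ i x s, ‖g i x s‖ ≤ G) (hG : 0 ≤ G) (hηl : 0 ≤ ηl)
    (hβ₂ : 0 ≤ β₂) (hβ₂' : β₂ ≤ 1) (hε : 0 ≤ ε) (hsmall : (ηl * K * G) ^ 2 ≤ ε) (t : ℕ) :
    (fedAMSState g K η ηl β₁ β₂ ε x₁ S ξ (t + 1)).model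
      = (fedAMSState g K η ηl β₁ β₂ ε x₁ S ξ t).model
        + (η / Real.sqrt ε) • (fedAMSState g K η ηl β₁ β₂ ε x₁ S ξ (t + 1)).mom := by
  ext j
  have e : (fedAMSState g K η ηl β₁ β₂ ε x₁ S ξ (t + 1)).model j
      = (fedAMSState g K η ηl β₁ β₂ ε x₁ S ξ t).model j
        + η * ((fedAMSState g K η ηl β₁ β₂ ε x₁ S ξ (t + 1)).mom j
          / Real.sqrt ((fedAMSState g K η ηl β₁ β₂ ε x₁ S ξ (t + 1)).bhat j)) := rfl
  rw [e, fedAMSState_bhat_succ hg hG hηl hβ₂ hβ₂' hε hsmall]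
  simp
  ring

theorem norm_fedAMSState_mom_le (hg : ∀ i x s, ‖g i x s‖ ≤ G) (hG : 0 ≤ G) (hηl : 0 ≤ ηl)
    (hβ₁ : 0 ≤ β₁) (hβ₁' : β₁ < 1) (t : ℕ) :
    ‖(fedAMSState g K η ηl β₁ β₂ ε x₁ S ξ t).mom‖ ≤ ηl * K * G := by
  induction t with
  | zero => simp [fedAMSState]; positivity
  | succ t ih =>
    rw [fedAMSState_mom_succ]
    refine (norm_add_le _ _).trans ?_
    rw [norm_smul, norm_smul, Real.norm_of_nonneg hβ₁, Real.norm_of_nonneg (by linarith)]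
    have h := norm_modelDiff_le hg hG hηl K (fedAMSState g K η ηl β₁ β₂ ε x₁ S ξ t).model (S t) (ξ t)
    nlinarith [mul_le_mul_of_nonneg_left ih hβ₁,
      mul_le_mul_of_nonneg_left h (sub_nonneg.2 hβ₁'.le)]

/-- The growth in `t` is harmless: the bound only serves to confine the model at a fixed time to a
ball, for integrability of the potential. -/
theorem norm_fedAMSState_model_le (hg : ∀ i x s, ‖g i x s‖ ≤ G) (hG : 0 ≤ G) (hηl : 0 ≤ ηl)
    (hη : 0 ≤ η) (hβ₁ : 0 ≤ β₁) (hβ₁' : β₁ < 1)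
    (hβ₂ : 0 ≤ β₂) (hβ₂' : β₂ ≤ 1) (hε : 0 ≤ ε) (hsmall : (ηl * K * G) ^ 2 ≤ ε) (t : ℕ) :
    ‖(fedAMSState g K η ηl β₁ β₂ ε x₁ S ξ t).model‖
      ≤ ‖x₁‖ + t * ((η / Real.sqrt ε) * (ηl * K * G)) := by
  induction t with
  | zero => simp [fedAMSState]
  | succ t ih =>
    rw [fedAMSState_model_succ hg hG hηl hβ₂ hβ₂' hε hsmall]
    refine (norm_add_le _ _).trans ?_
    have hα : 0 ≤ η / Real.sqrt ε := by positivity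
    rw [norm_smul, Real.norm_of_nonneg hα]
    have := mul_le_mul_of_nonneg_left (norm_fedAMSState_mom_le (K := K) (η := η) (β₂ := β₂) (ε := ε) (x₁ := x₁)
      (S := S) (ξ := ξ) hg hG hηl hβ₁ hβ₁' (t + 1)) hα
    push_cast
    linarith

end State

/-! ### Measurability -/

variable [MeasurableSpace Ξ]

/-- The `σ`-algebra on `α` is left free and only samples before step `k` are required, so the lemma
also yields measurability with respect to the past, which is what independence arguments need. -/
theorem measurable_localSGD {g : Vec d → Ξ → Vec d}
    (hg : Measurable fun p : Vec d × Ξ => g p.1 p.2) {α : Type*} [MeasurableSpace α]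
    {x : α → Vec d} {ξ : ℕ → α → Ξ} {k : ℕ} (hx : Measurable x)
    (hξ : ∀ j < k, Measurable (ξ j)) :
    Measurable fun a => localSGD g ηl (x a) (fun j => ξ j a) k := by
  induction k with
  | zero => exact hx
  | succ k ih =>
    have h := ih fun j hj => hξ j (by omega)
    exact h.sub ((hg.comp (h.prodMk (hξ k (by omega)))).fun_const_smul ηl)

theorem measurable_apply_of_countable {α β γ : Type*} [MeasurableSpace α] [MeasurableSpace β]
    [Countable β] [MeasurableSingletonClass β] [MeasurableSpace γ] {f : β → α → γ} {S : α → β}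
    (hf : ∀ b, Measurable (f b)) (hS : Measurable S) : Measurable fun a => f (S a) a := by
  have h : Measurable fun p : α × β => f p.2 p.1 := measurable_from_prod_countable_left hf
  exact h.comp (measurable_id.prodMk hS)

theorem measurable_modelDiff (hg : ∀ i, Measurable fun p : Vec d × Ξ => g i p.1 p.2)
    {α : Type*} [MeasurableSpace α] {K : ℕ}
    {x : α → Vec d} {S : α → Finset (Fin m)} {ξ : Fin m → ℕ → α → Ξ} (hx : Measurable x)
    (hS : Measurable S) (hξ : ∀ i k, Measurable (ξ i k)) :
    Measurable fun a => modelDiff g K ηl (x a) (S a) (fun i k => ξ i k a) := by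
  have hA : ∀ A : Finset (Fin m), Measurable fun a =>
      modelDiff g K ηl (x a) A (fun i k => ξ i k a) := by
    intro A
    have hsum : Measurable fun a =>
        ∑ i ∈ A, (localSGD (g i) ηl (x a) (fun k => ξ i k a) K - x a) :=
      Finset.measurable_fun_sum _ fun i _ =>
        (measurable_localSGD (hg i) hx fun k _ => hξ i k).sub hx
    exact hsum.fun_const_smul (1 / (A.card : ℝ))
  exact measurable_apply_of_countable hA hS

/-- In the small-step regime model and momentum evolve without `b` and `bhat`, so these two
components suffice for the induction. Requiring only rounds `s < t` allows the `σ`-algebra of the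
past. -/
theorem measurable_fedAMSState (hg : ∀ i, Measurable fun p : Vec d × Ξ => g i p.1 p.2)
    (hb : ∀ i x s, ‖g i x s‖ ≤ G) (hG : 0 ≤ G) (hηl : 0 ≤ ηl) {K : ℕ} {η β₁ β₂ ε : ℝ}
    (hβ₂ : 0 ≤ β₂) (hβ₂' : β₂ ≤ 1) (hε : 0 ≤ ε) (hsmall : (ηl * K * G) ^ 2 ≤ ε) {x₁ : Vec d}
    {α : Type*} [MeasurableSpace α] {S : ℕ → α → Finset (Fin m)} {ξ : ℕ → Fin m → ℕ → α → Ξ}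
    {t : ℕ} (hS : ∀ s < t, Measurable (S s)) (hξ : ∀ s < t, ∀ i k, Measurable (ξ s i k)) :
    (Measurable fun a =>
      (fedAMSState g K η ηl β₁ β₂ ε x₁ (fun s => S s a) (fun s i k => ξ s i k a) t).model) ∧
    Measurable fun a =>
      (fedAMSState g K η ηl β₁ β₂ ε x₁ (fun s => S s a) (fun s i k => ξ s i k a) t).mom := by
  induction t with
  | zero => exact ⟨measurable_const, measurable_const⟩
  | succ t ih =>
    obtain ⟨h1, h2⟩ := ih (fun s hs => hS s (by omega)) fun s hs => hξ s (by omega)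
    have h3 : Measurable fun a => (fedAMSState g K η ηl β₁ β₂ ε x₁ (fun s => S s a)
        (fun s i k => ξ s i k a) (t + 1)).mom := by
      simp only [fedAMSState_mom_succ]
      exact (h2.fun_const_smul β₁).add
        ((measurable_modelDiff hg h1 (hS t (by omega)) (hξ t (by omega))).fun_const_smul (1 - β₁))
    refine ⟨?_, h3⟩
    simp only [fedAMSState_model_succ hb hG hηl hβ₂ hβ₂' hε hsmall]
    exact h1.add (h3.fun_const_smul _)

end Paths

/-! ### Sampling without replacement -/

section Sampling

variable {m n : ℕ} {Ω : Type*} [MeasurableSpace Ω] {P : Measure Ω} [IsProbabilityMeasure P]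
  {S : Ω → Finset (Fin m)}

omit [IsProbabilityMeasure P] in
theorem measureReal_clients (hunif : ∀ A : Finset (Fin m), A.card = n →
      P (S ⁻¹' {A}) = ((m.choose n : ℕ) : ℝ≥0∞)⁻¹) {A : Finset (Fin m)} (hA : A.card = n) :
    P.real (S ⁻¹' {A}) = ((m.choose n : ℕ) : ℝ)⁻¹ := by
  simp [measureReal_def, hunif A hA]

/-- The `n`-element sets already carry total mass `1`, which leaves nothing for any other set. -/
theorem measureReal_clients_eq_zero (hnm : n ≤ m) (hS : Measurable S)
    (hunif : ∀ A : Finset (Fin m), A.card = n → P (S ⁻¹' {A}) = ((m.choose n : ℕ) : ℝ≥0∞)⁻¹)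
    {A : Finset (Fin m)} (hA : A.card ≠ n) : P.real (S ⁻¹' {A}) = 0 := by
  classical
  have htot : ∑ B : Finset (Fin m), P.real (S ⁻¹' {B}) = 1 := by
    have h := sum_measureReal_preimage_singleton (μ := P) (f := S) Finset.univ
      (fun B _ => hS (measurableSet_singleton B))
    simpa using h
  have hpow : ∑ B ∈ Finset.powersetCard n (Finset.univ : Finset (Fin m)), P.real (S ⁻¹' {B})
      = 1 := by
    rw [Finset.sum_congr rfl fun B hB => measureReal_clients hunif (Finset.mem_powersetCard.1 hB).2]
    have : ((m.choose n : ℕ) : ℝ) ≠ 0 := by exact_mod_cast (Nat.choose_pos hnm).ne'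
    simp [Finset.card_powersetCard, this]
  have hsub : insert A (Finset.powersetCard n (Finset.univ : Finset (Fin m))) ⊆ Finset.univ :=
    Finset.subset_univ _
  have hle := Finset.sum_le_sum_of_subset_of_nonneg hsub
    (f := fun B => P.real (S ⁻¹' {B})) fun _ _ _ => measureReal_nonneg
  rw [Finset.sum_insert (by simp [Finset.mem_powersetCard, hA]), hpow, htot] at hle
  exact le_antisymm (by linarith) measureReal_nonneg

theorem ae_card_clients (hnm : n ≤ m) (hS : Measurable S)
    (hunif : ∀ A : Finset (Fin m), A.card = n → P (S ⁻¹' {A}) = ((m.choose n : ℕ) : ℝ≥0∞)⁻¹) :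
    ∀ᵐ ω ∂P, (S ω).card = n := by
  rw [ae_iff]
  have : {ω | ¬ (S ω).card = n} ⊆ ⋃ A ∈ {A : Finset (Fin m) | A.card ≠ n}, S ⁻¹' {A} := by
    intro ω hω
    simpa using hω
  refine measure_mono_null this ((measure_biUnion_null_iff (Set.to_countable _)).2 fun A hA => ?_)
  have h := measureReal_clients_eq_zero hnm hS hunif hA
  rwa [measureReal_eq_zero_iff] at h

theorem integral_clients (hnm : n ≤ m) (hS : Measurable S)
    (hunif : ∀ A : Finset (Fin m), A.card = n → P (S ⁻¹' {A}) = ((m.choose n : ℕ) : ℝ≥0∞)⁻¹)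
    (φ : Finset (Fin m) → ℝ) :
    ∫ ω, φ (S ω) ∂P
      = ((m.choose n : ℕ) : ℝ)⁻¹ * ∑ A ∈ Finset.powersetCard n Finset.univ, φ A := by
  have : IsProbabilityMeasure (P.map S) := Measure.isProbabilityMeasure_map hS.aemeasurable
  rw [← integral_map (f := φ) hS.aemeasurable (measurable_of_countable φ).aestronglyMeasurable,
    integral_fintype .of_finite, Finset.mul_sum]
  symm
  refine Finset.sum_subset_zero_on_sdiff (Finset.subset_univ _) ?_ ?_
  · intro A hA
    have hA' : A.card ≠ n := by simpa [Finset.mem_powersetCard] using hA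
    rw [map_measureReal_apply hS (measurableSet_singleton A),
      measureReal_clients_eq_zero hnm hS hunif hA', zero_smul]
  · intro A hA
    rw [map_measureReal_apply hS (measurableSet_singleton A),
      measureReal_clients hunif (Finset.mem_powersetCard.1 hA).2, smul_eq_mul]

theorem integral_subset_clients [DecidableEq (Fin m)] (hnm : n ≤ m) (hS : Measurable S)
    (hunif : ∀ A : Finset (Fin m), A.card = n → P (S ⁻¹' {A}) = ((m.choose n : ℕ) : ℝ≥0∞)⁻¹)
    (B : Finset (Fin m)) (hB : B.card ≤ n) :
    ∫ ω, (if B ⊆ S ω then (1 : ℝ) else 0) ∂P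
      = ((m - B.card).choose (n - B.card) : ℕ) / ((m.choose n : ℕ) : ℝ) := by
  rw [integral_clients hnm hS hunif (fun A => if B ⊆ A then (1 : ℝ) else 0), Finset.sum_boole,
    Finset.card_filter_powersetCard_subset _ _ _ (Finset.subset_univ _) hB]
  simp [div_eq_inv_mul]

theorem integral_mem_clients (hn : 1 ≤ n) (hnm : n ≤ m) (hS : Measurable S)
    (hunif : ∀ A : Finset (Fin m), A.card = n → P (S ⁻¹' {A}) = ((m.choose n : ℕ) : ℝ≥0∞)⁻¹)
    (i : Fin m) : ∫ ω, (if i ∈ S ω then (1 : ℝ) else 0) ∂P = n / m := by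
  have h := integral_subset_clients hnm hS hunif {i} (by simpa using hn)
  simp only [Finset.singleton_subset_iff, Finset.card_singleton] at h
  rw [h]
  obtain ⟨n, rfl⟩ := Nat.exists_eq_add_of_le' hn
  obtain ⟨m, rfl⟩ := Nat.exists_eq_add_of_le' (hn.trans hnm)
  have h1 : (0 : ℝ) < ((m + 1).choose (n + 1) : ℕ) := by exact_mod_cast Nat.choose_pos hnm
  rw [div_eq_div_iff h1.ne' (by positivity)]
  have h2 := Nat.add_one_mul_choose_eq m n
  simp only [Nat.add_sub_cancel]
  have h3 : (((m + 1) * m.choose n : ℕ) : ℝ) = (((m + 1).choose (n + 1) * (n + 1) : ℕ) : ℝ) := by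
    rw [h2]
  push_cast at h3 ⊢
  linarith

/-- Two given clients participate with a probability that does not depend on them and is at most
`(n / m) ^ 2`. -/
theorem exists_integral_mem_mul_mem_clients (hn : 1 ≤ n) (hnm : n ≤ m) (hS : Measurable S)
    (hunif : ∀ A : Finset (Fin m), A.card = n → P (S ⁻¹' {A}) = ((m.choose n : ℕ) : ℝ≥0∞)⁻¹) :
    ∃ q : ℝ, 0 ≤ q ∧ q ≤ (n / m) ^ 2 ∧ ∀ i j : Fin m, i ≠ j →
      ∫ ω, (if i ∈ S ω then (1 : ℝ) else 0) * (if j ∈ S ω then (1 : ℝ) else 0) ∂P = q := by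
  have e : ∀ (i j : Fin m) ω,
      (if i ∈ S ω then (1 : ℝ) else 0) * (if j ∈ S ω then (1 : ℝ) else 0)
        = if ({i, j} : Finset (Fin m)) ⊆ S ω then (1 : ℝ) else 0 := by
    intro i j ω
    by_cases hi : i ∈ S ω <;> by_cases hj : j ∈ S ω <;> simp [Finset.insert_subset_iff, hi, hj]
  simp only [e]
  -- For `n = 1` no pair can participate. For `n ≥ 2` the probability is `n (n - 1) / (m (m - 1))`.
  rcases Nat.lt_or_ge n 2 with h2 | h2
  · refine ⟨0, le_rfl, by positivity, fun i j hij => ?_⟩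
    rw [integral_eq_zero_of_ae]
    filter_upwards [ae_card_clients hnm hS hunif] with ω hω
    have : ¬ ({i, j} : Finset (Fin m)) ⊆ S ω := by
      intro h
      have := Finset.card_le_card h
      rw [Finset.card_pair hij, hω] at this
      omega
    simp [this]
  · refine ⟨((m - 2).choose (n - 2) : ℕ) / ((m.choose n : ℕ) : ℝ), by positivity, ?_,
      fun i j hij => ?_⟩
    · obtain ⟨n, rfl⟩ := Nat.exists_eq_add_of_le' h2
      obtain ⟨m, rfl⟩ := Nat.exists_eq_add_of_le' (h2.trans hnm)
      have hnm' : (n : ℝ) ≤ m := by exact_mod_cast (by omega : n ≤ m)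
      have h1 : (0 : ℝ) < ((m + 2).choose (n + 2) : ℕ) := by exact_mod_cast Nat.choose_pos hnm
      have h3 : ((m : ℝ) + 2) * ((m + 1).choose (n + 1) : ℕ)
          = ((m + 2).choose (n + 2) : ℕ) * ((n : ℝ) + 2) := by
        exact_mod_cast Nat.add_one_mul_choose_eq (m + 1) (n + 1)
      have h4 : ((m : ℝ) + 1) * (m.choose n : ℕ) = ((m + 1).choose (n + 1) : ℕ) * ((n : ℝ) + 1) := by
        exact_mod_cast Nat.add_one_mul_choose_eq m n
      simp only [Nat.add_sub_cancel]
      push_cast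
      rw [div_le_iff₀ h1, div_pow, div_mul_eq_mul_div, le_div_iff₀ (by positivity)]
      set a : ℝ := ((m.choose n : ℕ) : ℝ)
      set b : ℝ := (((m + 1).choose (n + 1) : ℕ) : ℝ)
      set c : ℝ := (((m + 2).choose (n + 2) : ℕ) : ℝ)
      have hc : 0 ≤ c := h1.le
      have h5 : ((m : ℝ) + 1) * (a * (m + 2)) = ((n : ℝ) + 1) * ((n + 2) * c) := by
        linear_combination (m + 2 : ℝ) * h4 + (n + 1 : ℝ) * h3
      -- In the variables shifted by `2` this is `(n - 1) / (m - 1) ≤ n / m`, the only inequality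
      -- behind the bound by `(n / m) ^ 2`.
      have h6 : ((n : ℝ) + 1) * (m + 2) ≤ (m + 1) * (n + 2) := by nlinarith
      have h7 : ((m : ℝ) + 1) * (a * (m + 2) ^ 2) ≤ (m + 1) * ((n + 2) ^ 2 * c) := by
        calc ((m : ℝ) + 1) * (a * (m + 2) ^ 2)
            = (((m : ℝ) + 1) * (a * (m + 2))) * (m + 2) := by ring
          _ = (((n : ℝ) + 1) * (m + 2)) * ((n + 2) * c) := by rw [h5]; ring
          _ ≤ ((m + 1) * (n + 2)) * ((n + 2) * c) := by gcongr
          _ = (m + 1) * ((n + 2) ^ 2 * c) := by ring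
      exact le_of_mul_le_mul_left h7 (by positivity)
    · have h := integral_subset_clients hnm hS hunif {i, j} (by rw [Finset.card_pair hij]; exact h2)
      rwa [Finset.card_pair hij] at h

/-! ### Moments of averages over the sampled clients -/

variable {E : Type*} [NormedAddCommGroup E] [InnerProductSpace ℝ E] [CompleteSpace E]
  [MeasurableSpace E] [BorelSpace E] [SecondCountableTopology E] {δ : Fin m → Ω → E} {B : ℝ}

-- Indicators turn the sum over a random index set into a sum over fixed indices, whose terms factor
-- under independence of `S` and `δ`.
omit [CompleteSpace E] [MeasurableSpace E] [BorelSpace E]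
  [SecondCountableTopology E] in
theorem ae_average_clients_eq (hnm : n ≤ m) (hS : Measurable S)
    (hunif : ∀ A : Finset (Fin m), A.card = n → P (S ⁻¹' {A}) = ((m.choose n : ℕ) : ℝ≥0∞)⁻¹)
    (δ : Fin m → Ω → E) :
    (fun ω => (1 / ((S ω).card : ℝ)) • ∑ i ∈ S ω, δ i ω)
      =ᵐ[P] fun ω => (1 / (n : ℝ)) • ∑ i, (if i ∈ S ω then (1 : ℝ) else 0) • δ i ω := by
  filter_upwards [ae_card_clients hnm hS hunif] with ω hω
  rw [hω]
  simp [ite_smul, Finset.sum_ite_mem]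

-- The inclusion probability `n / m` turns the weight `1 / n` into `1 / m`, so sampling introduces
-- no bias.
omit [CompleteSpace E] in
theorem integral_average_clients (hn : 1 ≤ n) (hnm : n ≤ m) (hS : Measurable S)
    (hunif : ∀ A : Finset (Fin m), A.card = n → P (S ⁻¹' {A}) = ((m.choose n : ℕ) : ℝ≥0∞)⁻¹)
    (hδ : ∀ i, Measurable (δ i)) (hB : ∀ i ω, ‖δ i ω‖ ≤ B)
    (hind : IndepFun S (fun ω i => δ i ω) P) :
    ∫ ω, (1 / ((S ω).card : ℝ)) • ∑ i ∈ S ω, δ i ω ∂P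
      = (1 / (m : ℝ)) • ∑ i, ∫ ω, δ i ω ∂P := by
  have hc : ∀ i, Measurable fun A : Finset (Fin m) => if i ∈ A then (1 : ℝ) else 0 :=
    fun i => measurable_of_countable _
  have hcS : ∀ i, Measurable fun ω => if i ∈ S ω then (1 : ℝ) else 0 := fun i => (hc i).comp hS
  rw [integral_congr_ae (ae_average_clients_eq hnm hS hunif δ), integral_smul,
    integral_finsetSum]
  · have h : ∀ i, ∫ ω, (if i ∈ S ω then (1 : ℝ) else 0) • δ i ω ∂P
        = ((n : ℝ) / m) • ∫ ω, δ i ω ∂P := by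
      intro i
      have hi : IndepFun (fun ω => if i ∈ S ω then (1 : ℝ) else 0) (δ i) P :=
        hind.comp (φ := fun A => if i ∈ A then (1 : ℝ) else 0) (ψ := fun v : Fin m → E => v i) (hc i)
          (measurable_pi_apply i)
      rw [hi.integral_fun_smul_eq_smul_integral (hcS i).aestronglyMeasurable
        (hδ i).aestronglyMeasurable, integral_mem_clients hn hnm hS hunif]
    simp only [h, ← Finset.smul_sum, smul_smul]
    congr 1
    have : (n : ℝ) ≠ 0 := by positivity
    field_simp
  · intro i _
    refine Integrable.of_bound ((hcS i).smul (hδ i)).aestronglyMeasurable B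
      (Filter.Eventually.of_forall fun ω => ?_)
    have := (norm_nonneg _).trans (hB i ω)
    split_ifs <;> simp [hB i ω, this]

/-- Averaging over `n` clients sampled without replacement leaves a variance of order `1 / n`. -/
theorem integral_norm_sq_average_clients_le (hn : 1 ≤ n) (hnm : n ≤ m) (hS : Measurable S)
    (hunif : ∀ A : Finset (Fin m), A.card = n → P (S ⁻¹' {A}) = ((m.choose n : ℕ) : ℝ≥0∞)⁻¹)
    (hδ : ∀ i, Measurable (δ i)) (hB : ∀ i ω, ‖δ i ω‖ ≤ B)
    (hind : IndepFun S (fun ω i => δ i ω) P) (hpair : ∀ i j, i ≠ j → IndepFun (δ i) (δ j) P) :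
    ∫ ω, ‖(1 / ((S ω).card : ℝ)) • ∑ i ∈ S ω, δ i ω‖ ^ 2 ∂P
      ≤ B ^ 2 / n + ‖(1 / (m : ℝ)) • ∑ i, ∫ ω, δ i ω ∂P‖ ^ 2 := by
  obtain ⟨q, hq0, hq, hqe⟩ := exists_integral_mem_mul_mem_clients hn hnm hS hunif
  have hm : (0 : ℝ) < m := by exact_mod_cast hn.trans hnm
  have hn' : (0 : ℝ) < n := by exact_mod_cast hn
  have hB0 : ∀ i ω, 0 ≤ B := fun i ω => (norm_nonneg _).trans (hB i ω)
  set c : Fin m → Finset (Fin m) → ℝ := fun i A => if i ∈ A then (1 : ℝ) else 0 with hcdef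
  have hc : ∀ i, Measurable (c i) := fun i => measurable_of_countable _
  have hcS : ∀ i, Measurable fun ω => c i (S ω) := fun i => (hc i).comp hS
  have hc01 : ∀ i A, |c i A| ≤ 1 := by
    intro i A
    simp only [hcdef]
    split_ifs <;> simp
  have hδint : ∀ i, Integrable (δ i) P := fun i =>
    Integrable.of_bound (hδ i).aestronglyMeasurable B (Filter.Eventually.of_forall (hB i))
  have hin : ∀ i j ω, |inner ℝ (δ i ω) (δ j ω)| ≤ B * B := fun i j ω =>
    (abs_real_inner_le_norm _ _).trans
      (mul_le_mul (hB i ω) (hB j ω) (norm_nonneg _) (hB0 i ω))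
  have hinm : ∀ i j, Measurable fun ω => inner ℝ (δ i ω) (δ j ω) := fun i j =>
    (hδ i).inner (hδ j)
  set μ : Fin m → E := fun i => ∫ ω, δ i ω ∂P with hμ
  have hterm : ∀ i j, ∫ ω, (c i (S ω) * c j (S ω)) * inner ℝ (δ i ω) (δ j ω) ∂P
      = (∫ ω, c i (S ω) * c j (S ω) ∂P) * ∫ ω, inner ℝ (δ i ω) (δ j ω) ∂P := by
    intro i j
    have h : IndepFun (fun ω => c i (S ω) * c j (S ω)) (fun ω => inner ℝ (δ i ω) (δ j ω)) P :=
      hind.comp (φ := fun A => c i A * c j A) (ψ := fun v : Fin m → E => (inner ℝ (v i) (v j) : ℝ))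
        ((hc i).mul (hc j)) ((measurable_pi_apply i).inner (measurable_pi_apply j))
    exact h.integral_fun_mul_eq_mul_integral ((hcS i).mul (hcS j)).aestronglyMeasurable
      (hinm i j).aestronglyMeasurable
  have hoff : ∀ i j, i ≠ j → ∫ ω, (c i (S ω) * c j (S ω)) * inner ℝ (δ i ω) (δ j ω) ∂P
      = q * inner ℝ (μ i) (μ j) := by
    intro i j hij
    rw [hterm, hqe i j hij]
    congr 1
    exact (hpair i j hij).integral_bilin (hδint i) (hδint j) (innerSL ℝ)
  have hdiag : ∀ i, ∫ ω, (c i (S ω) * c i (S ω)) * inner ℝ (δ i ω) (δ i ω) ∂P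
      ≤ n / m * B ^ 2 := by
    intro i
    have e : ∀ ω, c i (S ω) * c i (S ω) = c i (S ω) := by
      intro ω
      simp only [hcdef]
      split_ifs <;> simp
    rw [hterm]
    simp only [e]
    rw [integral_mem_clients hn hnm hS hunif]
    refine mul_le_mul_of_nonneg_left ?_ (by positivity)
    have h := integral_mono (μ := P) (f := fun ω => inner ℝ (δ i ω) (δ i ω)) (g := fun _ => B ^ 2)
      (Integrable.of_bound (hinm i i).aestronglyMeasurable (B * B)
        (Filter.Eventually.of_forall (hin i i))) (integrable_const _) fun ω => by
          have := (abs_le.1 (hin i i ω)).2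
          simp only; linarith
    simpa using h
  have hsq : ∀ ω, ‖(1 / (n : ℝ)) • ∑ i, c i (S ω) • δ i ω‖ ^ 2
      = (1 / (n : ℝ)) ^ 2 * ∑ i, ∑ j, (c i (S ω) * c j (S ω)) * inner ℝ (δ i ω) (δ j ω) := by
    intro ω
    rw [norm_smul, mul_pow, Real.norm_of_nonneg (by positivity), ← real_inner_self_eq_norm_sq,
      sum_inner]
    congr 1
    refine Finset.sum_congr rfl fun i _ => ?_
    rw [inner_sum]
    refine Finset.sum_congr rfl fun j _ => ?_
    rw [real_inner_smul_left, real_inner_smul_right]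
    ring
  have hint : ∀ i j, Integrable (fun ω => (c i (S ω) * c j (S ω)) * inner ℝ (δ i ω) (δ j ω)) P := by
    intro i j
    refine Integrable.of_bound (((hcS i).mul (hcS j)).mul (hinm i j)).aestronglyMeasurable (B * B)
      (Filter.Eventually.of_forall fun ω => ?_)
    rw [Real.norm_eq_abs, abs_mul, abs_mul]
    have h1 := mul_le_one₀ (hc01 i (S ω)) (abs_nonneg _) (hc01 j (S ω))
    exact (mul_le_mul h1 (hin i j ω) (abs_nonneg _) zero_le_one).trans (by rw [one_mul])
  have hae := ae_average_clients_eq hnm hS hunif δ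
  have hE : ∫ ω, ‖(1 / ((S ω).card : ℝ)) • ∑ i ∈ S ω, δ i ω‖ ^ 2 ∂P
      = (1 / (n : ℝ)) ^ 2 * ∑ i, ∑ j,
        ∫ ω, (c i (S ω) * c j (S ω)) * inner ℝ (δ i ω) (δ j ω) ∂P := by
    rw [integral_congr_ae (g := fun ω => ‖(1 / (n : ℝ)) • ∑ i, c i (S ω) • δ i ω‖ ^ 2)
      (hae.mono fun ω h => by simp only at h ⊢; rw [h])]
    simp only [hsq]
    rw [integral_const_mul, integral_finsetSum _ fun i _ => integrable_finsetSum _ fun j _ => hint i j]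
    congr 1
    refine Finset.sum_congr rfl fun i _ => ?_
    rw [integral_finsetSum _ fun j _ => hint i j]
  -- The nonnegative term `q ‖μ i‖²` is added on the diagonal so that the double sum of the means
  -- closes up to `q ‖∑ μ i‖²`.
  have hbound : ∀ i j, ∫ ω, (c i (S ω) * c j (S ω)) * inner ℝ (δ i ω) (δ j ω) ∂P
      ≤ q * inner ℝ (μ i) (μ j) + if i = j then n / m * B ^ 2 else 0 := by
    intro i j
    by_cases hij : i = j
    · subst hij
      have : 0 ≤ q * inner ℝ (μ i) (μ i) := mul_nonneg hq0 real_inner_self_nonneg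
      simp only [if_true]
      linarith [hdiag i]
    · rw [hoff i j hij, if_neg hij, add_zero]
  have hμμ : ∑ i, ∑ j, q * inner ℝ (μ i) (μ j) = q * ‖∑ i, μ i‖ ^ 2 := by
    rw [← real_inner_self_eq_norm_sq, sum_inner, Finset.mul_sum]
    refine Finset.sum_congr rfl fun i _ => ?_
    rw [inner_sum, Finset.mul_sum]
  have hsum : ∑ i, ∑ j, ∫ ω, (c i (S ω) * c j (S ω)) * inner ℝ (δ i ω) (δ j ω) ∂P
      ≤ q * ‖∑ i, μ i‖ ^ 2 + n * B ^ 2 := by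
    refine (Finset.sum_le_sum fun i _ => Finset.sum_le_sum fun j _ => hbound i j).trans ?_
    simp only [Finset.sum_add_distrib, hμμ, Finset.sum_ite_eq, Finset.mem_univ, if_true,
      Finset.sum_const, Finset.card_univ, Fintype.card_fin, nsmul_eq_mul]
    apply le_of_eq
    field_simp
  rw [hE]
  calc (1 / (n : ℝ)) ^ 2 * ∑ i, ∑ j,
        ∫ ω, (c i (S ω) * c j (S ω)) * inner ℝ (δ i ω) (δ j ω) ∂P
      ≤ (1 / (n : ℝ)) ^ 2 * ((n / m) ^ 2 * ‖∑ i, μ i‖ ^ 2 + n * B ^ 2) := by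
        refine mul_le_mul_of_nonneg_left (hsum.trans ?_) (by positivity)
        gcongr
    _ = B ^ 2 / n + ‖(1 / (m : ℝ)) • ∑ i, μ i‖ ^ 2 := by
        rw [norm_smul, mul_pow, Real.norm_of_nonneg (by positivity : (0 : ℝ) ≤ 1 / m)]
        field_simp
        ring

end Sampling

/-! ### Independence in the random mechanism -/

section Independence

/-- Fubini for the product law of `(X, Y)`. It replaces conditional expectations: `X` may be frozen
while averaging over `Y`. -/
theorem integral_comp_prodMk_eq_of_indepFun {Ω α β E : Type*} [MeasurableSpace Ω] {P : Measure Ω}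
    [IsProbabilityMeasure P] [MeasurableSpace α] [MeasurableSpace β] [NormedAddCommGroup E]
    [NormedSpace ℝ E] [MeasurableSpace E] [BorelSpace E]
    [SecondCountableTopology E] {X : Ω → α} {Y : Ω → β} (hX : Measurable X) (hY : Measurable Y)
    (hXY : IndepFun X Y P) {h : α × β → E} (hh : Measurable h) {C : ℝ} (hC : ∀ p, ‖h p‖ ≤ C) :
    Integrable (fun ω => ∫ ω', h (X ω, Y ω') ∂P) P ∧
      ∫ ω, h (X ω, Y ω) ∂P = ∫ ω, ∫ ω', h (X ω, Y ω') ∂P ∂P := by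
  have : IsProbabilityMeasure (P.map X) := Measure.isProbabilityMeasure_map hX.aemeasurable
  have : IsProbabilityMeasure (P.map Y) := Measure.isProbabilityMeasure_map hY.aemeasurable
  have hint : Integrable h ((P.map X).prod (P.map Y)) :=
    Integrable.of_bound hh.aestronglyMeasurable C (Filter.Eventually.of_forall hC)
  have hin : ∀ x, ∫ y, h (x, y) ∂(P.map Y) = ∫ ω', h (x, Y ω') ∂P := fun x =>
    integral_map hY.aemeasurable (hh.comp measurable_prodMk_left).aestronglyMeasurable
  have hX' := hint.integral_prod_left
  constructor
  · have := hX'.comp_measurable hX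
    simpa only [Function.comp_def, hin] using this
  · have e := (indepFun_iff_map_prod_eq_prod_map_map hX.aemeasurable hY.aemeasurable).1 hXY
    have h1 := integral_map (μ := P) (hX.prodMk hY).aemeasurable
      (f := h) hh.aestronglyMeasurable
    rw [← h1, e, integral_prod _ hint, integral_map hX.aemeasurable hX'.aestronglyMeasurable]
    simp only [hin]

variable {d m n : ℕ} {Ξ : Type*} [MeasurableSpace Ξ] {D : Fin m → Measure Ξ}
  {Ω : Type*} [MeasurableSpace Ω] {P : Measure Ω}
  {S : ℕ → Ω → Finset (Fin m)} {ξ : ℕ → Fin m → ℕ → Ω → Ξ}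

/-- The `σ`-algebra of the information carried by the client sets and samples with indices in `A`. -/
@[reducible]
def information (S : ℕ → Ω → Finset (Fin m)) (ξ : ℕ → Fin m → ℕ → Ω → Ξ)
    (A : Set (ℕ ⊕ ℕ × Fin m × ℕ)) : MeasurableSpace Ω :=
  ⨆ q ∈ A, Sum.elim
      (fun t : ℕ => MeasurableSpace.comap (S t) ⊤)
      (fun q : ℕ × Fin m × ℕ =>
        MeasurableSpace.comap (ξ q.1 q.2.1 q.2.2) inferInstance) q

omit [MeasurableSpace Ω] in
theorem measurable_clients_information {A : Set (ℕ ⊕ ℕ × Fin m × ℕ)} {t : ℕ}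
    (h : Sum.inl t ∈ A) : Measurable[information S ξ A] (S t) := by
  rw [measurable_iff_comap_le]
  exact (MeasurableSpace.comap_mono le_top).trans (le_iSup₂_of_le (Sum.inl t) h le_rfl)

omit [MeasurableSpace Ω] in
theorem measurable_sample_information {A : Set (ℕ ⊕ ℕ × Fin m × ℕ)} {t k : ℕ} {i : Fin m}
    (h : Sum.inr (t, i, k) ∈ A) : Measurable[information S ξ A] (ξ t i k) := by
  rw [measurable_iff_comap_le]
  exact le_iSup₂_of_le (Sum.inr (t, i, k)) h le_rfl

theorem IsPartialParticipation.measurable_clients_fun (hp : IsPartialParticipation P D n S ξ)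
    (t : ℕ) : Measurable (S t) :=
  measurable_to_countable' (hp.measurable_clients t)

/-- Every independence claim about the algorithm is reduced to disjointness of two sets of indices.
-/
theorem IsPartialParticipation.indepFun (hp : IsPartialParticipation P D n S ξ)
    {A B : Set (ℕ ⊕ ℕ × Fin m × ℕ)} (hAB : Disjoint A B) {α β : Type*} [MeasurableSpace α]
    [MeasurableSpace β] {X : Ω → α} {Y : Ω → β} (hX : Measurable[information S ξ A] X)
    (hY : Measurable[information S ξ B] Y) : IndepFun X Y P := by
  rw [IndepFun_iff_Indep]
  have h := indep_iSup_of_disjoint (S := A) (T := B) ?_ hp.indep hAB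
  · exact indep_of_indep_of_le_left (indep_of_indep_of_le_right h hY.comap_le) hX.comap_le
  · rintro (t | ⟨t, i, k⟩)
    · rintro _ ⟨B, -, rfl⟩
      have : S t ⁻¹' B = ⋃ A ∈ B, S t ⁻¹' {A} := by ext; simp
      rw [this]
      exact MeasurableSet.biUnion (Set.to_countable _) fun A _ => hp.measurable_clients t A
    · exact (hp.measurable_samples t i k).comap_le

end Independence

/-! ### One round from a given model -/

section Round

variable {d m n : ℕ} {Ξ : Type*} [MeasurableSpace Ξ] {D : Fin m → Measure Ξ}
  [∀ i, IsProbabilityMeasure (D i)] {F : Fin m → Vec d → Ξ → ℝ} {L G ηl : ℝ}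
  {Ω : Type*} [MeasurableSpace Ω] {P : Measure Ω} [IsProbabilityMeasure P]
  {S : ℕ → Ω → Finset (Fin m)} {ξ : ℕ → Fin m → ℕ → Ω → Ξ}

omit [∀ i, IsProbabilityMeasure (D i)] in
theorem IsSmoothFamily.continuous_gradient (hs : IsSmoothFamily D F L) (hL : 0 ≤ L) (i : Fin m) :
    Continuous (gradient (localObj D F i)) := by
  refine (LipschitzWith.of_dist_le_mul (K := ⟨3 * L, by positivity⟩) fun x y => ?_).continuous
  rw [dist_eq_norm, dist_eq_norm]
  exact norm_gradient_sub_le_of_abs_taylor_le hL (hs i) x y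

/-- Conditionally on the current local model, the stochastic gradient is unbiased. -/
theorem integral_stochGrad_localSGD (hF : IsLossFamily D F) (hG : HasBoundedGrad F G)
    (hp : IsPartialParticipation P D n S ξ)
    (t : ℕ) (i : Fin m) (k : ℕ) (x : Vec d) :
    ∫ ω, stochGrad F i (localSGD (stochGrad F i) ηl x (fun j => ξ t i j ω) k) (ξ t i k ω) ∂P
      = ∫ ω, gradient (localObj D F i)
          (localSGD (stochGrad F i) ηl x (fun j => ξ t i j ω) k) ∂P := by
  have hg := hF.measurable_stochGrad i
  set y : Ω → Vec d := fun ω => localSGD (stochGrad F i) ηl x (fun j => ξ t i j ω) k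
  have hy : Measurable y :=
    measurable_localSGD hg measurable_const fun j _ => hp.measurable_samples t i j
  have hind : IndepFun y (ξ t i k) P := by
    -- The local model after `k` steps has used the samples `0, …, k - 1`; sample `k` is still
    -- fresh.
    refine hp.indepFun (A := {q | ∃ j < k, q = Sum.inr (t, i, j)}) (B := {Sum.inr (t, i, k)})
      ?_ ?_ (measurable_sample_information rfl)
    · rw [Set.disjoint_singleton_right]
      rintro ⟨j, hj, h⟩
      simp at h
      omega
    · exact @measurable_localSGD d Ξ ηl _ _ hg Ω (information S ξ _) (fun _ => x) (ξ t i) k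
        (@measurable_const _ _ _ (information S ξ _) x)
        fun j hj => measurable_sample_information ⟨j, hj, rfl⟩
  rw [(integral_comp_prodMk_eq_of_indepFun hy (hp.measurable_samples t i k) hind hg
    fun p => hG i p.1 p.2).2]
  refine integral_congr_ae (Filter.Eventually.of_forall fun ω => ?_)
  simp only
  rw [hF.gradient_localObj hG, ← hp.law_samples t i k,
    integral_map (hp.measurable_samples t i k).aemeasurable]
  exact (hg.comp measurable_prodMk_left).aestronglyMeasurable

omit [∀ i, IsProbabilityMeasure (D i)] [IsProbabilityMeasure P] in
theorem measurable_localSGD_samples (hF : IsLossFamily D F)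
    (hp : IsPartialParticipation P D n S ξ) (t : ℕ) (i : Fin m) (k : ℕ) (x : Vec d) :
    Measurable fun ω => localSGD (stochGrad F i) ηl x (fun j => ξ t i j ω) k :=
  measurable_localSGD (hF.measurable_stochGrad i) measurable_const
    fun j _ => hp.measurable_samples t i j

/-- Client drift. In expectation each stochastic gradient becomes the true gradient at the local
model, which is within `ηl K G` of `x`; the `3 L`-Lipschitz gradient then errs by at most `3 L (ηl K
G)` in each of the `K` steps. -/
theorem norm_integral_localSGD_sub_add_le (hL : 0 ≤ L) (hG0 : 0 ≤ G) (hηl : 0 ≤ ηl)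
    (hF : IsLossFamily D F) (hs : IsSmoothFamily D F L) (hG : HasBoundedGrad F G)
    (hp : IsPartialParticipation P D n S ξ) (t : ℕ) (i : Fin m) (K : ℕ) (x : Vec d) :
    ‖∫ ω, (localSGD (stochGrad F i) ηl x (fun j => ξ t i j ω) K - x) ∂P
        + (ηl * K) • gradient (localObj D F i) x‖ ≤ ηl * K * (3 * L * (ηl * K * G)) := by
  have hy := fun k => measurable_localSGD_samples (ηl := ηl) hF hp t i k x
  have hcont := hs.continuous_gradient hL i
  have hint1 : ∀ k, Integrable (fun ω => stochGrad F i
      (localSGD (stochGrad F i) ηl x (fun j => ξ t i j ω) k) (ξ t i k ω)) P := fun k =>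
    Integrable.of_bound ((hF.measurable_stochGrad i).comp
      ((hy k).prodMk (hp.measurable_samples t i k))).aestronglyMeasurable G
      (Filter.Eventually.of_forall fun ω => hG i _ _)
  have hint2 : ∀ k, Integrable (fun ω => gradient (localObj D F i)
      (localSGD (stochGrad F i) ηl x (fun j => ξ t i j ω) k)) P := fun k =>
    Integrable.of_bound (hcont.measurable.comp (hy k)).aestronglyMeasurable G
      (Filter.Eventually.of_forall fun ω => hF.norm_gradient_localObj_le hG i _)
  have e : ∫ ω, (localSGD (stochGrad F i) ηl x (fun j => ξ t i j ω) K - x) ∂P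
        + (ηl * K) • gradient (localObj D F i) x
      = ∑ k ∈ Finset.range K, (-ηl) • ∫ ω, (gradient (localObj D F i)
          (localSGD (stochGrad F i) ηl x (fun j => ξ t i j ω) k)
            - gradient (localObj D F i) x) ∂P := by
    simp only [localSGD_sub_eq_sum]
    have hint3 : ∀ k, Integrable (fun ω => (-ηl) • stochGrad F i
        (localSGD (stochGrad F i) ηl x (fun j => ξ t i j ω) k) (ξ t i k ω)) P := fun k =>
      (hint1 k).smul (-ηl)
    rw [integral_finsetSum _ fun k _ => hint3 k]
    have h : ∀ k ∈ Finset.range K, (-ηl) • ∫ ω, (gradient (localObj D F i)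
          (localSGD (stochGrad F i) ηl x (fun j => ξ t i j ω) k)
            - gradient (localObj D F i) x) ∂P
        = ∫ ω, (-ηl) • stochGrad F i
            (localSGD (stochGrad F i) ηl x (fun j => ξ t i j ω) k) (ξ t i k ω) ∂P
          + ηl • gradient (localObj D F i) x := by
      intro k _
      rw [integral_sub (hint2 k) (integrable_const _), integral_smul,
        integral_stochGrad_localSGD hF hG hp]
      simp [smul_sub]
    rw [Finset.sum_congr rfl h, Finset.sum_add_distrib]
    simp only [Finset.sum_const, Finset.card_range, ← Nat.cast_smul_eq_nsmul ℝ, smul_smul]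
    rw [mul_comm (K : ℝ)]
  rw [e]
  have hterm : ∀ k ∈ Finset.range K, ‖(-ηl) • ∫ ω, (gradient (localObj D F i)
          (localSGD (stochGrad F i) ηl x (fun j => ξ t i j ω) k)
            - gradient (localObj D F i) x) ∂P‖ ≤ ηl * (3 * L * (ηl * K * G)) := by
    intro k hk
    rw [norm_smul, norm_neg, Real.norm_of_nonneg hηl]
    refine mul_le_mul_of_nonneg_left ?_ hηl
    have hb : ∀ ω, ‖gradient (localObj D F i)
          (localSGD (stochGrad F i) ηl x (fun j => ξ t i j ω) k)
            - gradient (localObj D F i) x‖ ≤ 3 * L * (ηl * K * G) := by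
      intro ω
      refine (norm_gradient_sub_le_of_abs_taylor_le hL (hs i) _ _).trans ?_
      refine mul_le_mul_of_nonneg_left ?_ (by positivity)
      refine (norm_localSGD_sub_le (hG i) hηl x _ k).trans ?_
      have hk' : (k : ℝ) ≤ K := by exact_mod_cast (Finset.mem_range.1 hk).le
      have := mul_le_mul_of_nonneg_right hk' (mul_nonneg hηl hG0)
      linarith
    simpa using norm_integral_le_of_norm_le_const (μ := P) (Filter.Eventually.of_forall hb)
  refine (norm_sum_le_of_le _ hterm).trans (le_of_eq ?_)
  simp only [Finset.sum_const, Finset.card_range, nsmul_eq_mul]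
  ring

/-- The mean and the second moment of the pseudo-gradient of a round that starts from `x`. -/
theorem exists_mean_modelDiff (hn : 1 ≤ n) (hnm : n ≤ m) (hL : 0 ≤ L) (hG0 : 0 ≤ G)
    (hηl : 0 ≤ ηl) (hF : IsLossFamily D F) (hs : IsSmoothFamily D F L) (hG : HasBoundedGrad F G)
    (hp : IsPartialParticipation P D n S ξ) (t K : ℕ) (x : Vec d) :
    ∃ v : Vec d,
      ∫ ω, modelDiff (stochGrad F) K ηl x (S t ω) (fun i k => ξ t i k ω) ∂P = v ∧
      ‖v + (ηl * K) • gradient (globalObj D F) x‖ ≤ ηl * K * (3 * L * (ηl * K * G)) ∧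
      ∫ ω, ‖modelDiff (stochGrad F) K ηl x (S t ω) (fun i k => ξ t i k ω)‖ ^ 2 ∂P
        ≤ (ηl * K * G) ^ 2 / n + ‖v‖ ^ 2 := by
  have hS := hp.measurable_clients_fun t
  set δ : Fin m → Ω → Vec d := fun i ω =>
    localSGD (stochGrad F i) ηl x (fun j => ξ t i j ω) K - x with hδdef
  have hδ : ∀ i, Measurable (δ i) := fun i =>
    (measurable_localSGD_samples hF hp t i K x).sub measurable_const
  have hδinf : ∀ (A : Set (ℕ ⊕ ℕ × Fin m × ℕ)) i, (∀ k, Sum.inr (t, i, k) ∈ A) →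
      Measurable[information S ξ A] (δ i) := by
    intro A i hA
    have h := @measurable_localSGD d Ξ ηl _ _ (hF.measurable_stochGrad i) Ω (information S ξ A)
      (fun _ => x) (ξ t i) K (@measurable_const _ _ _ (information S ξ A) x)
      fun j _ => measurable_sample_information (hA j)
    exact h.sub (@measurable_const _ _ _ (information S ξ A) x)
  have hB : ∀ i ω, ‖δ i ω‖ ≤ ηl * K * G := by
    intro i ω
    refine (norm_localSGD_sub_le (hG i) hηl x _ K).trans (le_of_eq (by ring))
  have hind : IndepFun (S t) (fun ω i => δ i ω) P := by
    refine hp.indepFun (A := {Sum.inl t}) (B := Set.range Sum.inr) ?_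
      (measurable_clients_information rfl) ?_
    · simp
    · exact @measurable_pi_lambda _ _ _ (information S ξ _) _ _ fun i => hδinf _ i fun k => ⟨_, rfl⟩
  -- This relies on `x` being deterministic: two clients then share no randomness.
  have hpair : ∀ i j, i ≠ j → IndepFun (δ i) (δ j) P := by
    intro i j hij
    refine hp.indepFun (A := Set.range fun k => Sum.inr (t, i, k))
      (B := Set.range fun k => Sum.inr (t, j, k)) ?_
      (hδinf _ i fun k => ⟨k, rfl⟩) (hδinf _ j fun k => ⟨k, rfl⟩)
    rw [Set.disjoint_left]
    rintro _ ⟨k, rfl⟩ ⟨l, h⟩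
    simp at h
    exact hij h.1.symm
  refine ⟨(1 / (m : ℝ)) • ∑ i, ∫ ω, δ i ω ∂P,
    integral_average_clients hn hnm hS (hp.uniform_clients t) hδ hB hind, ?_,
    integral_norm_sq_average_clients_le hn hnm hS (hp.uniform_clients t) hδ hB hind hpair⟩
  rw [hF.gradient_globalObj hG, smul_comm, ← smul_add, Finset.smul_sum, ← Finset.sum_add_distrib,
    norm_smul, Real.norm_of_nonneg (by positivity)]
  have h := norm_sum_le_of_le Finset.univ fun i _ =>
    norm_integral_localSGD_sub_add_le hL hG0 hηl hF hs hG hp t i K x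
  simp only [Finset.sum_const, Finset.card_univ, Fintype.card_fin, nsmul_eq_mul] at h
  have hm : (0 : ℝ) < m := by exact_mod_cast hn.trans hnm
  rw [one_div, inv_mul_le_iff₀ hm]
  exact h

omit [∀ i, IsProbabilityMeasure (D i)] in
theorem integrable_modelDiff (hG0 : 0 ≤ G) (hηl : 0 ≤ ηl) (hF : IsLossFamily D F)
    (hG : HasBoundedGrad F G) (hp : IsPartialParticipation P D n S ξ) (t K : ℕ) (x : Vec d) :
    Integrable (fun ω => modelDiff (stochGrad F) K ηl x (S t ω) (fun i k => ξ t i k ω)) P :=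
  Integrable.of_bound (measurable_modelDiff hF.measurable_stochGrad measurable_const
    (hp.measurable_clients_fun t) (hp.measurable_samples t)).aestronglyMeasurable (ηl * K * G)
    (Filter.Eventually.of_forall fun _ => norm_modelDiff_le hG hG0 hηl K x _ _)

omit [∀ i, IsProbabilityMeasure (D i)] in
theorem integrable_norm_sq_modelDiff (hG0 : 0 ≤ G) (hηl : 0 ≤ ηl) (hF : IsLossFamily D F)
    (hG : HasBoundedGrad F G) (hp : IsPartialParticipation P D n S ξ) (t K : ℕ) (x : Vec d) :
    Integrable (fun ω =>
      ‖modelDiff (stochGrad F) K ηl x (S t ω) (fun i k => ξ t i k ω)‖ ^ 2) P :=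
  Integrable.of_bound ((measurable_modelDiff hF.measurable_stochGrad measurable_const
    (hp.measurable_clients_fun t) (hp.measurable_samples t)).norm.pow_const 2).aestronglyMeasurable
    ((ηl * K * G) ^ 2)
    (Filter.Eventually.of_forall fun _ => by
      rw [norm_pow, norm_norm]
      have := norm_modelDiff_le (Ξ := Ξ) (g := stochGrad F) hG hG0 hηl K x
      gcongr
      exact this _ _)

/-- The expected decrease in a round that starts from the model `x`. -/
theorem integral_inner_add_norm_sq_modelDiff_le (hn : 1 ≤ n) (hnm : n ≤ m) (hL : 0 ≤ L)
    (hG0 : 0 ≤ G) (hηl : 0 < ηl) (hF : IsLossFamily D F) (hs : IsSmoothFamily D F L)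
    (hG : HasBoundedGrad F G) (hp : IsPartialParticipation P D n S ξ) (t : ℕ) {K : ℕ}
    (hK : 1 ≤ K) {α A : ℝ} (hα : 0 ≤ α) (hA : 0 ≤ A) (hαA : 2 * A * (α * (ηl * K)) ≤ 1)
    (x : Vec d) :
    ∫ ω, (α * inner ℝ (gradient (globalObj D F) x)
          (modelDiff (stochGrad F) K ηl x (S t ω) (fun i k => ξ t i k ω))
        + A * α ^ 2 * ‖modelDiff (stochGrad F) K ηl x (S t ω) (fun i k => ξ t i k ω)‖ ^ 2) ∂P
      ≤ α * (ηl * K) / 2 * ((3 * L * (ηl * K * G)) ^ 2 - ‖gradient (globalObj D F) x‖ ^ 2)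
        + A * α ^ 2 * ((ηl * K * G) ^ 2 / n) := by
  obtain ⟨v, hv, hvn, hv2⟩ := exists_mean_modelDiff hn hnm hL hG0 hηl.le hF hs hG hp t K x
  have hint := integrable_modelDiff hG0 hηl.le hF hG hp t K x
  have hint2 := integrable_norm_sq_modelDiff hG0 hηl.le hF hG hp t K x
  rw [integral_add ((hint.const_inner _).const_mul α) (hint2.const_mul _), integral_const_mul,
    integral_const_mul, integral_inner hint, hv]
  set u := gradient (globalObj D F) x
  have hK' : (0 : ℝ) < K := by exact_mod_cast hK
  set γ := ηl * K with hγ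
  have hγ0 : 0 < γ := by positivity
  set Q := 3 * L * (γ * G) with hQ
  have hQ0 : 0 ≤ Q := by positivity
  -- Expanding the drift bound for `v + γ u` keeps the term `‖v‖²`. Under `2 A α γ ≤ 1` it absorbs
  -- the part `A α² ‖v‖²` of the second moment, so that only the variance, of order `1 / n`,
  -- remains.
  have hsq : ‖v‖ ^ 2 + 2 * γ * inner ℝ u v + γ ^ 2 * ‖u‖ ^ 2 ≤ γ ^ 2 * Q ^ 2 := by
    have h1 : ‖v + γ • u‖ ^ 2 ≤ (γ * Q) ^ 2 := by gcongr
    rw [norm_add_sq_real, real_inner_smul_right, norm_smul, Real.norm_of_nonneg hγ0.le,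
      real_inner_comm] at h1
    nlinarith
  have h2 := mul_le_mul_of_nonneg_left hv2 (by positivity : 0 ≤ A * α ^ 2)
  have h3 : α * inner ℝ u v + A * α ^ 2 * ‖v‖ ^ 2 ≤ α * γ / 2 * (Q ^ 2 - ‖u‖ ^ 2) := by
    have h4 : 2 * A * (α * γ) * (α * ‖v‖ ^ 2) ≤ 1 * (α * ‖v‖ ^ 2) := by gcongr
    have h5 := mul_le_mul_of_nonneg_left hsq hα
    have h6 : γ * (α * inner ℝ u v + A * α ^ 2 * ‖v‖ ^ 2)
        ≤ γ * (α * γ / 2 * (Q ^ 2 - ‖u‖ ^ 2)) := by nlinarith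
    exact le_of_mul_le_mul_left h6 hγ0
  linarith

end Round

/-! ### Descent of the potential -/

section Descent

/-- One step of SGD with momentum `β` decreases the potential
`f (x + (α β / (1 - β)) v) + (3 L α² / (2 (1 - β)²)) ‖v‖²` up to second-order terms. -/
theorem potential_momentum_step_le {E : Type*} [NormedAddCommGroup E] [InnerProductSpace ℝ E]
    [CompleteSpace E] {f : E → ℝ} {L α β : ℝ} (hL : 0 ≤ L)
    (h : ∀ x y, |f x - f y - inner ℝ (gradient f y) (x - y)| ≤ L / 2 * ‖x - y‖ ^ 2)
    (hα : 0 ≤ α) (hβ : 0 ≤ β) (hβ' : β < 1) {x v Δ x' v' : E}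
    (hv' : v' = β • v + (1 - β) • Δ) (hx' : x' = x + α • v') :
    f (x' + (α * β / (1 - β)) • v') + 3 * L * α ^ 2 / (2 * (1 - β) ^ 2) * ‖v'‖ ^ 2
      ≤ f (x + (α * β / (1 - β)) • v) + 3 * L * α ^ 2 / (2 * (1 - β) ^ 2) * ‖v‖ ^ 2
        + (α * inner ℝ (gradient f x) Δ + (3 * L / (1 - β) + L / 2) * α ^ 2 * ‖Δ‖ ^ 2) := by
  have h1β : 0 < 1 - β := by linarith
  set z := x + (α * β / (1 - β)) • v with hz
  -- The shift is chosen so that all coefficients of `v` cancel: `z` performs SGD without momentum.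
  have hz' : x' + (α * β / (1 - β)) • v' = z + α • Δ := by
    rw [hx', hz, hv']
    have e1 : α * β + (α * β / (1 - β)) * β = α * β / (1 - β) := by field_simp; ring
    have e2 : α * (1 - β) + (α * β / (1 - β)) * (1 - β) = α := by field_simp; ring
    rw [← sub_eq_zero]
    have : x + α • (β • v + (1 - β) • Δ) + (α * β / (1 - β)) • (β • v + (1 - β) • Δ)
        - (x + (α * β / (1 - β)) • v + α • Δ)
        = (α * β + (α * β / (1 - β)) * β - α * β / (1 - β)) • v
          + (α * (1 - β) + (α * β / (1 - β)) * (1 - β) - α) • Δ := by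
      module
    rw [this, e1, e2]
    simp
  have hdesc := (abs_le.1 (h (z + α • Δ) z)).2
  rw [add_sub_cancel_left, inner_smul_right, norm_smul, Real.norm_of_nonneg hα] at hdesc
  have hlip := norm_gradient_sub_le_of_abs_taylor_le hL h z x
  have hzx : ‖z - x‖ ≤ α / (1 - β) * ‖v‖ := by
    rw [hz, add_sub_cancel_left, norm_smul, Real.norm_of_nonneg (by positivity)]
    gcongr
    nlinarith
  -- Descent is natural at `z`, but the mean of `Δ` is known in terms of the gradient at `x`; the
  -- exchange costs a cross term in `‖v‖ ‖Δ‖`.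
  have hin : inner ℝ (gradient f z) Δ - inner ℝ (gradient f x) Δ
      ≤ 3 * L * (α / (1 - β)) * (‖v‖ * ‖Δ‖) := by
    rw [← inner_sub_left]
    calc inner ℝ (gradient f z - gradient f x) Δ ≤ ‖gradient f z - gradient f x‖ * ‖Δ‖ :=
          real_inner_le_norm _ _
      _ ≤ (3 * L * (α / (1 - β) * ‖v‖)) * ‖Δ‖ := by
          gcongr
          exact hlip.trans (by gcongr)
      _ = _ := by ring
  have hvv : ‖v‖ * ‖Δ‖ ≤ (‖v‖ ^ 2 + ‖Δ‖ ^ 2) / 2 := by nlinarith [sq_nonneg (‖v‖ - ‖Δ‖)]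
  -- With `κ` the weight of `‖v‖²` in the potential, this convexity bound releases `κ (1 - β) ‖v‖²`.
  -- As `κ (1 - β) = 3 L α² / (2 (1 - β))`, it cancels the `‖v‖²` half of the cross term exactly.
  -- The equal coefficient of `‖Δ‖²` occurs twice, giving `3 L / (1 - β)`; the `L / 2` is the
  -- smoothness remainder.
  have hmom : ‖v'‖ ^ 2 ≤ β * ‖v‖ ^ 2 + (1 - β) * ‖Δ‖ ^ 2 := by
    have h1 : ‖v'‖ ≤ β * ‖v‖ + (1 - β) * ‖Δ‖ := by
      rw [hv']
      refine (norm_add_le _ _).trans (le_of_eq ?_)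
      rw [norm_smul, norm_smul, Real.norm_of_nonneg hβ, Real.norm_of_nonneg h1β.le]
    have h2 : ‖v'‖ ^ 2 ≤ (β * ‖v‖ + (1 - β) * ‖Δ‖) ^ 2 := by gcongr
    nlinarith [mul_nonneg (mul_nonneg hβ h1β.le) (sq_nonneg (‖v‖ - ‖Δ‖))]
  rw [hz']
  have hκ : 0 ≤ 3 * L * α ^ 2 / (2 * (1 - β) ^ 2) := by positivity
  have h3 := mul_le_mul_of_nonneg_left hmom hκ
  have h4 := mul_le_mul_of_nonneg_left hin hα
  have h5 := mul_le_mul_of_nonneg_left hvv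
    (by positivity : 0 ≤ α * (3 * L * (α / (1 - β))))
  have e3 : 3 * L * α ^ 2 / (2 * (1 - β) ^ 2) * (β * ‖v‖ ^ 2 + (1 - β) * ‖Δ‖ ^ 2)
      = 3 * L * α ^ 2 / (2 * (1 - β) ^ 2) * ‖v‖ ^ 2
        + 3 * L * α ^ 2 / (2 * (1 - β)) * (‖Δ‖ ^ 2 - ‖v‖ ^ 2) := by
    field_simp
    ring
  have e4 : α * (3 * L * (α / (1 - β))) * ((‖v‖ ^ 2 + ‖Δ‖ ^ 2) / 2)
      = 3 * L * α ^ 2 / (2 * (1 - β)) * (‖v‖ ^ 2 + ‖Δ‖ ^ 2) := by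
    field_simp
  have e5 : 3 * L / (1 - β) * α ^ 2 * ‖Δ‖ ^ 2 = 2 * (3 * L * α ^ 2 / (2 * (1 - β)) * ‖Δ‖ ^ 2) := by
    field_simp
  rw [e3] at h3
  rw [e4] at h5
  linear_combination hdesc + h3 + h4 + h5 - e5

end Descent

/-! ### Convergence for small steps -/

section Convergence

variable {d m n : ℕ} {Ξ : Type*} [MeasurableSpace Ξ] {D : Fin m → Measure Ξ}
  [∀ i, IsProbabilityMeasure (D i)] {F : Fin m → Vec d → Ξ → ℝ} {L G ηl : ℝ}
  {Ω : Type*} [MeasurableSpace Ω] {P : Measure Ω} [IsProbabilityMeasure P]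
  {S : ℕ → Ω → Finset (Fin m)} {ξ : ℕ → Fin m → ℕ → Ω → Ξ}
  {K : ℕ} {η β₁ β₂ ε : ℝ}

theorem IsLossFamily.continuous_gradient_globalObj (hF : IsLossFamily D F)
    (hG : HasBoundedGrad F G) (hs : IsSmoothFamily D F L) (hL : 0 ≤ L) :
    Continuous (gradient (globalObj D F)) := by
  refine (LipschitzWith.of_dist_le_mul (K := ⟨3 * L, by positivity⟩) fun x y => ?_).continuous
  rw [dist_eq_norm, dist_eq_norm]
  exact norm_gradient_sub_le_of_abs_taylor_le hL (hF.abs_globalObj_taylor_le hG hs hL) x y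

theorem IsLossFamily.continuous_globalObj (hF : IsLossFamily D F) (hG : HasBoundedGrad F G) :
    Continuous (globalObj D F) :=
  continuous_iff_continuousAt.2 fun x => (hF.hasGradientAt_globalObj hG x).differentiableAt.continuousAt

omit [∀ i, IsProbabilityMeasure (D i)] [IsProbabilityMeasure P] in
/-- The model at the start of a round is independent of the randomness of that round. -/
theorem indepFun_model_round (hG0 : 0 ≤ G) (hηl : 0 ≤ ηl) (hβ₂ : 0 ≤ β₂) (hβ₂' : β₂ ≤ 1)
    (hε : 0 ≤ ε) (hsmall : (ηl * K * G) ^ 2 ≤ ε) (hF : IsLossFamily D F)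
    (hG : HasBoundedGrad F G) (hp : IsPartialParticipation P D n S ξ) (x₁ : Vec d) (t : ℕ) :
    IndepFun
      (fun ω => fedAMS (stochGrad F) K η ηl β₁ β₂ ε x₁ (fun s => S s ω)
        (fun s i k => ξ s i k ω) t)
      (fun ω => (S t ω, fun i k => ξ t i k ω)) P := by
  let round : ℕ ⊕ ℕ × Fin m × ℕ → ℕ := Sum.elim id Prod.fst
  refine hp.indepFun (A := {q | round q < t}) (B := {q | round q = t}) ?_ ?_ ?_
  · rw [Set.disjoint_left]
    intro q h1 h2
    exact absurd h2 (ne_of_lt h1)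
  · exact (@measurable_fedAMSState d m Ξ (stochGrad F) G ηl _ hF.measurable_stochGrad hG hG0 hηl
      K η β₁ β₂ ε hβ₂ hβ₂' hε hsmall x₁ Ω (information S ξ _) S ξ t
      (fun s hs => measurable_clients_information hs)
      (fun s hs i k => measurable_sample_information hs)).1
  · have h1 : Measurable[information S ξ {q | round q = t}] (S t) :=
      measurable_clients_information rfl
    have h2 : Measurable[information S ξ {q | round q = t}] fun ω i k => ξ t i k ω :=
      @measurable_pi_lambda _ _ _ (information S ξ _) _ _ fun i =>
        @measurable_pi_lambda _ _ _ (information S ξ _) _ _ fun k =>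
          measurable_sample_information rfl
    exact h1.prodMk h2

/-- The expected first- and second-order change of the objective in round `t`. -/
theorem integral_round_le (hn : 1 ≤ n) (hnm : n ≤ m) (hL : 0 ≤ L)
    (hG0 : 0 ≤ G) (hηl : 0 < ηl) (hβ₂ : 0 ≤ β₂) (hβ₂' : β₂ ≤ 1)
    (hε : 0 ≤ ε) (hsmall : (ηl * K * G) ^ 2 ≤ ε) (hF : IsLossFamily D F)
    (hs : IsSmoothFamily D F L) (hG : HasBoundedGrad F G)
    (hp : IsPartialParticipation P D n S ξ) (hK : 1 ≤ K) {α A : ℝ} (hα : 0 ≤ α) (hA : 0 ≤ A)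
    (hαA : 2 * A * (α * (ηl * K)) ≤ 1) (x₁ : Vec d) (t : ℕ) {x : Ω → Vec d}
    (hx : x = fun ω => fedAMS (stochGrad F) K η ηl β₁ β₂ ε x₁ (fun s => S s ω)
      (fun s i k => ξ s i k ω) t) :
    Integrable (fun ω => ‖gradient (globalObj D F) (x ω)‖ ^ 2) P ∧
    Integrable (fun ω => α * inner ℝ (gradient (globalObj D F) (x ω))
          (modelDiff (stochGrad F) K ηl (x ω) (S t ω) (fun i k => ξ t i k ω))
        + A * α ^ 2
          * ‖modelDiff (stochGrad F) K ηl (x ω) (S t ω) (fun i k => ξ t i k ω)‖ ^ 2) P ∧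
    ∫ ω, (α * inner ℝ (gradient (globalObj D F) (x ω))
          (modelDiff (stochGrad F) K ηl (x ω) (S t ω) (fun i k => ξ t i k ω))
        + A * α ^ 2
          * ‖modelDiff (stochGrad F) K ηl (x ω) (S t ω) (fun i k => ξ t i k ω)‖ ^ 2) ∂P
      ≤ α * (ηl * K) / 2 * ((3 * L * (ηl * K * G)) ^ 2
          - ∫ ω, ‖gradient (globalObj D F) (x ω)‖ ^ 2 ∂P)
        + A * α ^ 2 * ((ηl * K * G) ^ 2 / n) := by
  have hm : 1 ≤ m := hn.trans hnm
  have hcont := hF.continuous_gradient_globalObj hG hs hL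
  have hxm : Measurable x := by
    rw [hx]
    exact (measurable_fedAMSState hF.measurable_stochGrad hG hG0 hηl.le hβ₂ hβ₂' hε hsmall
      (fun s _ => hp.measurable_clients_fun s) (fun s _ => hp.measurable_samples s)).1
  set Y : Ω → Finset (Fin m) × (Fin m → ℕ → Ξ) := fun ω => (S t ω, fun i k => ξ t i k ω) with hY
  have hYm : Measurable Y := by
    refine (hp.measurable_clients_fun t).prodMk ?_
    exact measurable_pi_lambda _ fun i => measurable_pi_lambda _ fun k => hp.measurable_samples t i k
  have hind : IndepFun x Y P := by
    rw [hx]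
    exact indepFun_model_round hG0 hηl.le hβ₂ hβ₂' hε hsmall hF hG hp x₁ t
  set h : Vec d × Finset (Fin m) × (Fin m → ℕ → Ξ) → ℝ := fun p =>
    α * inner ℝ (gradient (globalObj D F) p.1)
        (modelDiff (stochGrad F) K ηl p.1 p.2.1 (fun i k => p.2.2 i k))
      + A * α ^ 2 * ‖modelDiff (stochGrad F) K ηl p.1 p.2.1 (fun i k => p.2.2 i k)‖ ^ 2 with hh
  have hΔm : Measurable fun p : Vec d × Finset (Fin m) × (Fin m → ℕ → Ξ) =>
      modelDiff (stochGrad F) K ηl p.1 p.2.1 (fun i k => p.2.2 i k) := by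
    refine measurable_modelDiff hF.measurable_stochGrad measurable_fst
      (measurable_fst.comp measurable_snd) fun i k => ?_
    exact (measurable_pi_apply k).comp
      ((measurable_pi_apply i).comp (measurable_snd.comp measurable_snd))
  have hhm : Measurable h :=
    (((hcont.measurable.comp measurable_fst).inner hΔm).const_mul α).add
      ((hΔm.norm.pow_const 2).const_mul _)
  have hhb : ∀ p, ‖h p‖ ≤ α * (G * (ηl * K * G)) + A * α ^ 2 * (ηl * K * G) ^ 2 := by
    intro p
    have h1 := norm_modelDiff_le (g := stochGrad F) hG hG0 hηl.le K p.1 p.2.1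
      (fun i k => p.2.2 i k)
    have h2 := (abs_real_inner_le_norm (gradient (globalObj D F) p.1)
      (modelDiff (stochGrad F) K ηl p.1 p.2.1 (fun i k => p.2.2 i k))).trans
      (mul_le_mul (hF.norm_gradient_globalObj_le hG hm p.1) h1 (norm_nonneg _) hG0)
    refine (norm_add_le _ _).trans (add_le_add ?_ ?_)
    · rw [Real.norm_eq_abs, abs_mul, abs_of_nonneg hα]
      gcongr
    · rw [Real.norm_of_nonneg (by positivity)]
      gcongr
  have hgrad : Integrable (fun ω => ‖gradient (globalObj D F) (x ω)‖ ^ 2) P :=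
    Integrable.of_bound ((hcont.measurable.comp hxm).norm.pow_const 2).aestronglyMeasurable (G ^ 2)
      (Filter.Eventually.of_forall fun ω => by
        rw [norm_pow, norm_norm]
        gcongr
        exact hF.norm_gradient_globalObj_le hG hm _)
  refine ⟨hgrad, Integrable.of_bound (hhm.comp (hxm.prodMk hYm)).aestronglyMeasurable _
    (Filter.Eventually.of_forall fun ω => hhb (x ω, Y ω)), ?_⟩
  -- The model is frozen here, which allows the estimate for a deterministic starting point to be
  -- integrated over `x ω`.
  obtain ⟨hi, he⟩ := integral_comp_prodMk_eq_of_indepFun hxm hYm hind hhm hhb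
  refine (le_of_eq he).trans ?_
  have hsub : Integrable (fun ω => (3 * L * (ηl * K * G)) ^ 2
      - ‖gradient (globalObj D F) (x ω)‖ ^ 2) P := (integrable_const _).sub hgrad
  have hbound : Integrable (fun ω => α * (ηl * K) / 2 * ((3 * L * (ηl * K * G)) ^ 2
      - ‖gradient (globalObj D F) (x ω)‖ ^ 2) + A * α ^ 2 * ((ηl * K * G) ^ 2 / n)) P :=
    (hsub.const_mul _).add (integrable_const _)
  refine (integral_mono hi hbound fun ω =>
    integral_inner_add_norm_sq_modelDiff_le hn hnm hL hG0 hηl hF hs hG hp t hK hα hA hαA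
      (x ω)).trans (le_of_eq ?_)
  rw [integral_add (hsub.const_mul _) (integrable_const _), integral_const_mul,
    integral_sub (integrable_const _) hgrad]
  simp

/-- Convergence of FedAMS with partial participation, for steps so small that the running maximum
of the second moments stays at its floor. -/
theorem sum_integral_norm_sq_gradient_le (hn : 1 ≤ n) (hnm : n ≤ m) (hL : 0 ≤ L)
    (hG0 : 0 ≤ G) (hη : 0 ≤ η) (hηl : 0 < ηl) (hβ₁ : 0 ≤ β₁) (hβ₁' : β₁ < 1) (hβ₂ : 0 ≤ β₂)
    (hβ₂' : β₂ ≤ 1) (hε : 0 ≤ ε) (hsmall : (ηl * K * G) ^ 2 ≤ ε) (hF : IsLossFamily D F)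
    (hs : IsSmoothFamily D F L) (hG : HasBoundedGrad F G)
    (hp : IsPartialParticipation P D n S ξ) (hK : 1 ≤ K)
    (hstep : 2 * (3 * L / (1 - β₁) + L / 2) * (η / Real.sqrt ε * (ηl * K)) ≤ 1)
    (hbdd : BddBelow (Set.range (globalObj D F))) (x₁ : Vec d) (T : ℕ) {x : ℕ → Ω → Vec d}
    (hx : x = fun t ω => fedAMS (stochGrad F) K η ηl β₁ β₂ ε x₁ (fun s => S s ω)
      (fun s i k => ξ s i k ω) t) :
    (∀ t, Integrable (fun ω => ‖gradient (globalObj D F) (x t ω)‖ ^ 2) P) ∧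
    η / Real.sqrt ε * (ηl * K) / 2
        * ∑ t ∈ Finset.range T, ∫ ω, ‖gradient (globalObj D F) (x t ω)‖ ^ 2 ∂P
      ≤ globalObj D F x₁ - (⨅ y, globalObj D F y)
        + T * (η / Real.sqrt ε * (ηl * K) / 2 * (3 * L * (ηl * K * G)) ^ 2
          + (3 * L / (1 - β₁) + L / 2) * (η / Real.sqrt ε) ^ 2 * ((ηl * K * G) ^ 2 / n)) := by
  set α := η / Real.sqrt ε with hα
  have hα0 : 0 ≤ α := by positivity
  have h1β : 0 < 1 - β₁ := by linarith
  set A := 3 * L / (1 - β₁) + L / 2 with hA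
  have hA0 : 0 ≤ A := by positivity
  set f := globalObj D F with hf
  have hround := fun t => integral_round_le hn hnm hL hG0 hηl hβ₂ hβ₂' hε hsmall hF hs hG hp hK
    hα0 hA0 hstep x₁ t (x := x t) (η := η) (β₁ := β₁) (by rw [hx])
  refine ⟨fun t => (hround t).1, ?_⟩
  set s : ℕ → Ω → ServerState d := fun t ω =>
    fedAMSState (stochGrad F) K η ηl β₁ β₂ ε x₁ (fun s => S s ω) (fun s i k => ξ s i k ω) t with hsdef
  have hxs : ∀ t ω, x t ω = (s t ω).model := fun t ω => by rw [hx]; rfl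
  have hsm : ∀ t, Measurable (fun ω => (s t ω).model) ∧ Measurable fun ω => (s t ω).mom := fun t =>
    measurable_fedAMSState hF.measurable_stochGrad hG hG0 hηl.le hβ₂ hβ₂' hε hsmall
      (fun r _ => hp.measurable_clients_fun r) (fun r _ => hp.measurable_samples r)
  set κ := 3 * L * α ^ 2 / (2 * (1 - β₁) ^ 2) with hκ
  have hκ0 : 0 ≤ κ := by positivity
  set Φ : ℕ → Ω → ℝ := fun t ω =>
    f ((s t ω).model + (α * β₁ / (1 - β₁)) • (s t ω).mom) + κ * ‖(s t ω).mom‖ ^ 2 with hΦ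
  have hΦint : ∀ t, Integrable (Φ t) P := by
    intro t
    -- At a fixed time the shifted point lies in a deterministic ball of radius `R`, on which the
    -- continuous objective is bounded.
    set R := ‖x₁‖ + t * (α * (ηl * K * G)) + (α * β₁ / (1 - β₁)) * (ηl * K * G) with hR
    obtain ⟨C, hC⟩ := (isCompact_closedBall (0 : Vec d) R).exists_bound_of_continuousOn
      (hF.continuous_globalObj hG).continuousOn
    refine Integrable.of_bound (C := C + κ * (ηl * K * G) ^ 2) ?_
      (Filter.Eventually.of_forall fun ω => ?_)
    · exact (((hF.continuous_globalObj hG).measurable.comp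
        ((hsm t).1.add ((hsm t).2.fun_const_smul _))).add
          (((hsm t).2.norm.pow_const 2).const_mul κ)).aestronglyMeasurable
    · have hmom : ‖(s t ω).mom‖ ≤ ηl * K * G :=
        norm_fedAMSState_mom_le hG hG0 hηl.le hβ₁ hβ₁' t
      have hmod : ‖(s t ω).model‖ ≤ ‖x₁‖ + t * (α * (ηl * K * G)) :=
        norm_fedAMSState_model_le hG hG0 hηl.le hη hβ₁ hβ₁' hβ₂ hβ₂' hε hsmall t
      refine (norm_add_le _ _).trans (add_le_add (hC _ ?_) ?_)
      · rw [mem_closedBall_zero_iff]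
        refine (norm_add_le _ _).trans (add_le_add hmod ?_)
        rw [norm_smul, Real.norm_of_nonneg (by positivity)]
        gcongr
      · rw [Real.norm_of_nonneg (by positivity)]
        gcongr
  have hΦstep : ∀ t, ∫ ω, Φ (t + 1) ω ∂P ≤ ∫ ω, Φ t ω ∂P
      + (α * (ηl * K) / 2 * ((3 * L * (ηl * K * G)) ^ 2
          - ∫ ω, ‖gradient f (x t ω)‖ ^ 2 ∂P) + A * α ^ 2 * ((ηl * K * G) ^ 2 / n)) := by
    intro t
    obtain ⟨-, hi, hle⟩ := hround t
    refine le_trans ?_ (add_le_add le_rfl hle)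
    rw [← integral_add (hΦint t) hi]
    refine integral_mono (hΦint (t + 1)) ((hΦint t).add hi) fun ω => ?_
    have := potential_momentum_step_le hL (hF.abs_globalObj_taylor_le hG hs hL) hα0 hβ₁ hβ₁'
      (fedAMSState_mom_succ (g := stochGrad F) (K := K) (η := η) (ηl := ηl) (β₁ := β₁) (β₂ := β₂)
        (ε := ε) (x₁ := x₁) (S := fun s => S s ω) (ξ := fun s i k => ξ s i k ω) t)
      (fedAMSState_model_succ hG hG0 hηl.le hβ₂ hβ₂' hε hsmall t)
    simp only [hxs]
    exact this
  have hsum : ∀ N : ℕ, ∫ ω, Φ N ω ∂P ≤ f x₁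
      + (N * (α * (ηl * K) / 2 * (3 * L * (ηl * K * G)) ^ 2
          + A * α ^ 2 * ((ηl * K * G) ^ 2 / n))
        - α * (ηl * K) / 2 * ∑ t ∈ Finset.range N, ∫ ω, ‖gradient f (x t ω)‖ ^ 2 ∂P) := by
    intro N
    induction N with
    | zero => simp [hΦ, hsdef, fedAMSState]
    | succ N ih =>
      rw [Finset.sum_range_succ]
      push_cast
      have := hΦstep N
      linarith
  have hlow : (⨅ y, f y) ≤ ∫ ω, Φ T ω ∂P := by
    have h := integral_mono (μ := P) (integrable_const (⨅ y, f y)) (hΦint T) fun ω => by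
      have h1 : (⨅ y, f y) ≤ f ((s T ω).model + (α * β₁ / (1 - β₁)) • (s T ω).mom) :=
        ciInf_le hbdd _
      have h2 : 0 ≤ κ * ‖(s T ω).mom‖ ^ 2 := by positivity
      simp only [hΦ]
      linarith
    simpa using h
  have := hsum T
  linarith

end Convergence

/-! ### Arithmetic of the step sizes -/

/-- The convergence rate for step sizes `α γ` of order `p q / τ` and `γ` of order `1 / τ`; it is
applied to `p = √K`, `q = √n` and `τ = √T`. -/
theorem rate_le {A L G r a₁ a₂ b₁ b₂ p q τ α γ gap M : ℝ} (hA0 : 0 ≤ A) (hL : 0 ≤ L) (hG : 0 ≤ G)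
    (hr0 : 0 < r) (ha₁ : 0 < a₁) (hb₁ : 0 < b₁) (hp1 : 1 ≤ p) (hq1 : 1 ≤ q) (hτpq : p * q ≤ τ)
    (hγ0 : 0 < γ) (hα0 : 0 < α) (hgap : 0 ≤ gap) (hγ2 : γ ≤ b₂ / τ)
    (hαγ1 : a₁ * b₁ * (p * q) / (r * τ) ≤ α * γ) (hαγ2 : α * γ ≤ a₂ * b₂ * (p * q) / (r * τ))
    (hM : α * γ / 2 * (τ ^ 2 * M) ≤ gap + τ ^ 2 * (α * γ / 2 * (3 * L * (γ * G)) ^ 2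
        + A * α ^ 2 * ((γ * G) ^ 2 / q ^ 2))) :
    M ≤ (1 + 2 * gap * r / (a₁ * b₁) + 9 * L ^ 2 * G ^ 2 * b₂ ^ 2
      + 2 * A * G ^ 2 * (a₂ * b₂) / r) * (p / (τ * q)) := by
  have hp0 : 0 < p := by linarith
  have hq0 : 0 < q := by linarith
  have hτ0 : 0 < τ := lt_of_lt_of_le (by positivity) hτpq
  have hMle : M ≤ 2 * gap / (α * γ * τ ^ 2) + (3 * L * (γ * G)) ^ 2
      + 2 * A * (α * γ) * G ^ 2 / q ^ 2 := by
    have e : α * γ / 2 * τ ^ 2 * (2 * gap / (α * γ * τ ^ 2) + (3 * L * (γ * G)) ^ 2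
        + 2 * A * (α * γ) * G ^ 2 / q ^ 2) = gap + τ ^ 2 * (α * γ / 2 * (3 * L * (γ * G)) ^ 2
        + A * α ^ 2 * ((γ * G) ^ 2 / q ^ 2)) := by
      field_simp
      ring
    refine le_of_mul_le_mul_left ?_ (by positivity : 0 < α * γ / 2 * τ ^ 2)
    rw [e]
    linarith
  have hρ0 : 0 ≤ p / (τ * q) := by positivity
  -- The initial gap contributes only `1 / (p τ q)`; a factor `p²` is given away.
  have ht1 : 2 * gap / (α * γ * τ ^ 2) ≤ 2 * gap * r / (a₁ * b₁) * (p / (τ * q)) := by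
    calc 2 * gap / (α * γ * τ ^ 2) ≤ 2 * gap / (a₁ * b₁ * (p * q) / (r * τ) * τ ^ 2) := by gcongr
      _ = 2 * gap * r / (a₁ * b₁) * (1 / (p * τ * q)) := by field_simp
      _ ≤ 2 * gap * r / (a₁ * b₁) * (p / (τ * q)) := by
        refine mul_le_mul_of_nonneg_left ?_ (by positivity)
        rw [div_le_div_iff₀ (by positivity) (by positivity)]
        have := mul_le_mul_of_nonneg_right (one_le_pow₀ hp1 (n := 2)) (mul_pos hτ0 hq0).le
        linarith
  -- The drift contributes `1 / τ²`, which is at most `p / (τ q)` as soon as `q ≤ p τ`.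
  have ht2 : (3 * L * (γ * G)) ^ 2 ≤ 9 * L ^ 2 * G ^ 2 * b₂ ^ 2 * (p / (τ * q)) := by
    calc (3 * L * (γ * G)) ^ 2 ≤ (3 * L * (b₂ / τ * G)) ^ 2 := by gcongr
      _ = 9 * L ^ 2 * G ^ 2 * b₂ ^ 2 * (1 / τ ^ 2) := by field_simp; ring
      _ ≤ 9 * L ^ 2 * G ^ 2 * b₂ ^ 2 * (p / (τ * q)) := by
        refine mul_le_mul_of_nonneg_left ?_ (by positivity)
        rw [div_le_div_iff₀ (by positivity) (by positivity)]
        have h1 : q ≤ p * τ := (le_mul_of_one_le_left hq0.le hp1).trans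
          (hτpq.trans (le_mul_of_one_le_left hτ0.le hp1))
        have := mul_le_mul_of_nonneg_right h1 hτ0.le
        linarith
  -- The sampling variance sets the rate: `(p q / τ) / q²` is exactly `p / (τ q)`.
  have ht3 : 2 * A * (α * γ) * G ^ 2 / q ^ 2 ≤ 2 * A * G ^ 2 * (a₂ * b₂) / r * (p / (τ * q)) := by
    calc 2 * A * (α * γ) * G ^ 2 / q ^ 2
        ≤ 2 * A * (a₂ * b₂ * (p * q) / (r * τ)) * G ^ 2 / q ^ 2 := by gcongr
      _ = 2 * A * G ^ 2 * (a₂ * b₂) / r * (p / (τ * q)) := by field_simp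
  linarith

/-- Bounds for the step sizes `γ = ηl K` and `α γ` with `α = η / r`, and the two smallness
conditions that hold when `τ` is large. -/
theorem step_bounds {A G ε r a₁ a₂ b₁ b₂ p q τ η γ : ℝ} (hA0 : 0 ≤ A) (hG : 0 ≤ G)
    (hε : 0 < ε) (hr0 : 0 < r) (ha₁ : 0 < a₁) (hb₁ : 0 < b₁) (hp1 : 1 ≤ p) (hq1 : 1 ≤ q)
    (hτ0 : 0 < τ) (hη1 : a₁ * (p * q) ≤ η) (hη2 : η ≤ a₂ * (p * q)) (hγ1 : b₁ / τ ≤ γ)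
    (hγ2 : γ ≤ b₂ / τ)
    (hτ : (1 + b₂ ^ 2 * G ^ 2 / ε + (2 * A * (a₂ * b₂) / r) ^ 2) * (p ^ 2 * q ^ 2) ≤ τ ^ 2) :
    p * q ≤ τ ∧ (γ * G) ^ 2 ≤ ε ∧ a₁ * b₁ * (p * q) / (r * τ) ≤ η / r * γ ∧
      η / r * γ ≤ a₂ * b₂ * (p * q) / (r * τ) ∧ 2 * A * (η / r * γ) ≤ 1 := by
  have hp0 : 0 < p := by linarith
  have hq0 : 0 < q := by linarith
  have hγ0 : 0 < γ := lt_of_lt_of_le (by positivity) hγ1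
  have hη0 : 0 < η := lt_of_lt_of_le (by positivity) hη1
  have hpq : 1 ≤ p ^ 2 * q ^ 2 :=
    one_le_mul_of_one_le_of_one_le (one_le_pow₀ hp1) (one_le_pow₀ hq1)
  have hu : 0 ≤ b₂ ^ 2 * G ^ 2 / ε := by positivity
  have hw : 0 ≤ (2 * A * (a₂ * b₂) / r) ^ 2 := by positivity
  have hupq := mul_nonneg hu (zero_le_one.trans hpq)
  have hwpq := mul_nonneg hw (zero_le_one.trans hpq)
  have hαγ2 : η / r * γ ≤ a₂ * b₂ * (p * q) / (r * τ) := by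
    have := hη0.le.trans hη2
    calc η / r * γ ≤ (a₂ * (p * q) / r) * (b₂ / τ) := by gcongr
      _ = a₂ * b₂ * (p * q) / (r * τ) := by field_simp
  -- In `hτ` the summand `1` gives `p q ≤ τ`, the second keeps the squared pseudo-gradients below
  -- `ε`, and the third gives the step condition `2 A α γ ≤ 1`.
  refine ⟨?_, ?_, ?_, hαγ2, ?_⟩
  · refine le_of_sq_le_sq ?_ hτ0.le
    rw [mul_pow]
    linarith
  · have h1 : (γ * G) ^ 2 ≤ (b₂ / τ * G) ^ 2 := by gcongr
    refine h1.trans ?_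
    have h2 : b₂ ^ 2 * G ^ 2 / ε ≤ τ ^ 2 := by
      have := mul_le_mul_of_nonneg_left hpq hu
      linarith
    rw [div_le_iff₀ hε] at h2
    rw [mul_pow, div_pow, div_mul_eq_mul_div, div_le_iff₀ (by positivity)]
    linarith
  · calc a₁ * b₁ * (p * q) / (r * τ) = (a₁ * (p * q) / r) * (b₁ / τ) := by field_simp
      _ ≤ η / r * γ := by gcongr
  · have h1 : 2 * A * (a₂ * b₂) / r * (p * q) ≤ τ := by
      refine le_of_sq_le_sq ?_ hτ0.le
      rw [mul_pow, mul_pow p q]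
      linarith
    calc 2 * A * (η / r * γ) ≤ 2 * A * (a₂ * b₂ * (p * q) / (r * τ)) := by gcongr
      _ = (2 * A * (a₂ * b₂) / r * (p * q)) / τ := by field_simp
      _ ≤ 1 := (div_le_one hτ0).2 h1

end FedOpt

/-! ### Choice of the constants and conclusion -/

theorem mainTheorem6 (d : ℕ) (L G σl σg ε β₁ β₂ gap : ℝ) (a₁ a₂ b₁ b₂ : ℝ)
    (hL : 0 ≤ L) (hG : 0 ≤ G) (hε : 0 < ε)
    (hβ₁ : 0 ≤ β₁) (hβ₁' : β₁ < 1) (hβ₂ : 0 ≤ β₂) (hβ₂' : β₂ ≤ 1)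
    (ha₁ : 0 < a₁) (hb₁ : 0 < b₁) :
    ∃ C C₀ : ℝ, 0 < C ∧ 0 < C₀ ∧
      ∀ (m n K T : ℕ) (_ : 1 ≤ n) (_ : n ≤ m) (_ : 1 ≤ K) (hT : 1 ≤ T)
        -- the horizon is sufficiently large
        (_ : C₀ * K * n ≤ T)
        -- the federated problem and its assumptions
        (Ξ : Type*) [MeasurableSpace Ξ]
        (D : Fin m → MeasureTheory.Measure Ξ) [∀ i, MeasureTheory.IsProbabilityMeasure (D i)]
        (F : Fin m → FedOpt.Vec d → Ξ → ℝ)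
        (_ : FedOpt.IsLossFamily D F)
        (_ : FedOpt.IsSmoothFamily D F L)
        (_ : FedOpt.HasBoundedGrad F G)
        (_ : FedOpt.HasLocalVariance D F σl)
        (_ : FedOpt.HasGlobalVariance D F σg)
        (x₁ : FedOpt.Vec d)
        (_ : BddBelow (Set.range (FedOpt.globalObj D F)))
        (_ : FedOpt.globalObj D F x₁ - ⨅ x, FedOpt.globalObj D F x ≤ gap)
        -- `η = Θ(√(K n))` and `ηl = Θ(1 / (√T K))`
        (η ηl : ℝ)
        (_ : a₁ * Real.sqrt (K * n) ≤ η) (_ : η ≤ a₂ * Real.sqrt (K * n))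
        (_ : b₁ * (1 / (Real.sqrt T * K)) ≤ ηl) (_ : ηl ≤ b₂ * (1 / (Real.sqrt T * K)))
        -- the randomness of the algorithm
        (Ω : Type*) [MeasurableSpace Ω]
        (P : MeasureTheory.Measure Ω) [MeasureTheory.IsProbabilityMeasure P]
        (S : ℕ → Ω → Finset (Fin m)) (ξ : ℕ → Fin m → ℕ → Ω → Ξ)
        (_ : FedOpt.IsPartialParticipation P D n S ξ),
        let x : ℕ → Ω → FedOpt.Vec d := fun t ω =>
          FedOpt.fedAMS (FedOpt.stochGrad F) K η ηl β₁ β₂ ε x₁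
            (fun s => S s ω) (fun s i k => ξ s i k ω) t
        (∀ t, MeasureTheory.Integrable
          (fun ω => ‖gradient (FedOpt.globalObj D F) (x t ω)‖ ^ 2) P) ∧
        (Finset.range T).inf' (Finset.nonempty_range_iff.mpr (by omega))
          (fun t => ∫ ω, ‖gradient (FedOpt.globalObj D F) (x t ω)‖ ^ 2 ∂P)
          ≤ C * (Real.sqrt K / Real.sqrt (T * n)) := by
  have h1β : 0 < 1 - β₁ := by linarith
  set A := 3 * L / (1 - β₁) + L / 2 with hA
  have hA0 : 0 ≤ A := by positivity
  set r := Real.sqrt ε with hr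
  have hr0 : 0 < r := Real.sqrt_pos.2 hε
  -- `C` and `C₀` come from `rate_le` and `step_bounds`. The absolute values and the leading `1`
  -- secure positivity before any step size is given: the signs of `a₂` and `b₂` follow only from
  -- the existence of `η` and `ηl`.
  refine ⟨1 + 2 * |gap| * r / (a₁ * b₁) + 9 * L ^ 2 * G ^ 2 * b₂ ^ 2
      + 2 * A * G ^ 2 * |a₂ * b₂| / r,
    1 + b₂ ^ 2 * G ^ 2 / ε + (2 * A * (a₂ * b₂) / r) ^ 2, by positivity, by positivity, ?_⟩
  intro m n K T hn hnm hK hT hT0 Ξ _ D _ F hF hs hbg _ _ x₁ hbdd hgap η ηl hη1 hη2 hηl1 hηl2 Ω _ P _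
    S ξ hp x
  have hn0 : (1 : ℝ) ≤ n := by exact_mod_cast hn
  have hK0 : (1 : ℝ) ≤ K := by exact_mod_cast hK
  have hT1 : (1 : ℝ) ≤ T := by exact_mod_cast hT
  set τ := Real.sqrt T with hτ
  have hτ0 : 0 < τ := Real.sqrt_pos.2 (by linarith)
  have hτ2 : τ ^ 2 = T := Real.sq_sqrt (by linarith)
  set p := Real.sqrt K with hpdef
  have hp1 : 1 ≤ p := Real.one_le_sqrt.2 hK0
  have hp2 : p ^ 2 = K := Real.sq_sqrt (by linarith)
  set q := Real.sqrt n with hqdef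
  have hq1 : 1 ≤ q := Real.one_le_sqrt.2 hn0
  have hq2 : q ^ 2 = n := Real.sq_sqrt (by linarith)
  have hp0 : 0 < p := by linarith
  have hq0 : 0 < q := by linarith
  have hKn : Real.sqrt (K * n) = p * q := Real.sqrt_mul (by linarith) _
  have hTn : Real.sqrt (T * n) = τ * q := Real.sqrt_mul (by linarith) _
  rw [hKn] at hη1 hη2
  rw [hTn]
  have hKpos : (0 : ℝ) < K := by linarith
  -- the effective step sizes
  set γ := ηl * K with hγ
  have hγ1 : b₁ / τ ≤ γ := by
    have := mul_le_mul_of_nonneg_right hηl1 hKpos.le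
    refine le_trans (le_of_eq ?_) this
    field_simp
  have hγ2 : γ ≤ b₂ / τ := by
    have := mul_le_mul_of_nonneg_right hηl2 hKpos.le
    refine this.trans (le_of_eq ?_)
    field_simp
  have hγ0 : 0 < γ := lt_of_lt_of_le (by positivity) hγ1
  have hηl0 : 0 < ηl := pos_of_mul_pos_left hγ0 hKpos.le
  have hη0 : 0 < η := lt_of_lt_of_le (by positivity) hη1
  have hb₂ : 0 < b₂ := by
    have := hγ0.trans_le hγ2
    by_contra hneg
    exact absurd (div_nonpos_of_nonpos_of_nonneg (not_lt.1 hneg) hτ0.le) (not_le.2 this)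
  have ha₂ : 0 < a₂ := by
    have := hη0.trans_le hη2
    exact pos_of_mul_pos_left this (by positivity)
  have hT0' : (1 + b₂ ^ 2 * G ^ 2 / ε + (2 * A * (a₂ * b₂) / r) ^ 2) * (p ^ 2 * q ^ 2)
      ≤ τ ^ 2 := by rw [hp2, hq2, hτ2, ← mul_assoc]; exact hT0
  obtain ⟨hτpq, hγG, hαγ1, hαγ2, hstep⟩ := FedOpt.step_bounds hA0 hG hε hr0 ha₁ hb₁ hp1 hq1 hτ0
    hη1 hη2 hγ1 hγ2 hT0'
  obtain ⟨hint, hsum⟩ := FedOpt.sum_integral_norm_sq_gradient_le hn hnm hL hG hη0.le hηl0 hβ₁ hβ₁'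
    hβ₂ hβ₂' hε.le hγG hF hs hbg hp hK hstep hbdd x₁ T (x := x) rfl
  refine ⟨hint, ?_⟩
  rw [abs_of_pos (mul_pos ha₂ hb₂)]
  refine FedOpt.rate_le hA0 hL hG hr0 ha₁ hb₁ hp1 hq1 hτpq hγ0 (div_pos hη0 hr0) (abs_nonneg gap)
    hγ2 hαγ1 hαγ2 ?_
  rw [hτ2, hq2]
  have hmin : T * (Finset.range T).inf' (Finset.nonempty_range_iff.mpr (by omega))
        (fun t => ∫ ω, ‖gradient (FedOpt.globalObj D F) (x t ω)‖ ^ 2 ∂P)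
      ≤ ∑ t ∈ Finset.range T, ∫ ω, ‖gradient (FedOpt.globalObj D F) (x t ω)‖ ^ 2 ∂P := by
    rw [← nsmul_eq_mul]
    simpa using Finset.card_nsmul_le_sum (Finset.range T)
      (fun t => ∫ ω, ‖gradient (FedOpt.globalObj D F) (x t ω)‖ ^ 2 ∂P) _
      fun t ht => Finset.inf'_le _ ht
  have hα0 : 0 < η / r := by positivity
  refine (mul_le_mul_of_nonneg_left hmin (by positivity)).trans (hsum.trans ?_)
  exact add_le_add (hgap.trans (le_abs_self _)) le_rfl
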